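/- Let $n\ge 2$ and $N\ge 1$. Let $J$ be the space of infinite jets $(x,u,\partial u,\partial^2u,\dots)$ of one dependent variable $u$ in $n$ independent variables $x=(x^1,\dots,x^n)$, with coordinates $x^i$ and $u_K$ for all unordered multi-indices $K$, and with the product topology. Let $U\subseteq J$ be open. A differential function on $U$ is a smooth function of $x$ and of finitely many of the $u_K$; it has order at most $k$ if it is a smooth function of $x$ and the $u_K$ with $|K|\le k$. Let $$D_i=\partial_{x^i}+\sum_K u_{i,K}\,\partial_{u_K},\qquad E_u(L)=\sum_K(-1)^{|K|}D_K(L_{u_K})$$ be the total derivatives and the Euler–Lagrange operator. Let $G$ be a differential function of order at most $N$ on $U$ that is Euler–Lagrange, i.e. $G=E_u(L)$ on $U$ for some differential function $L$, and let $$\mathcal E=\{p\in U:\ (D_KG)(p)=0\ \text{for all multi-indices } K\ (\text{including } K=\emptyset)\}$$ be the space of formal solutions of $G=0$. Let $W$ be a variational integrating factor of $G$: a differential function on $U$, not identically zero, such that $WG=E_u(\tilde L)$ on $U$ for some differential function $\tilde L$. Then at every point $p\in\mathcal E$ at which $W|_{\mathcal E}$ is non-constant (meaning that $W$ is constant on no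 neighbourhood of $p$ in $\mathcal E$), the matrix $$\Big(\tbinom{i,K}{i}\,G_{u_{i,K}}(p)\Big),$$ whose rows are indexed by the multi-indices $K$ with $|K|=N-1$ and whose columns are indexed by $i=1,\dots,n$, has rank at most $n-1$. Here $\binom{i,K}{i}$ is the number of occurrences of $i$ in the multi-index $(i,K)$. -/

import Mathlib

open scoped ContDiff Topology

noncomputable section

namespace JetCalculus

/-- The infinite jet space `J = (x, u, ∂u, ∂²u, …)` of one dependent variable `u` in `n`
independent variables: a point `p` has base coordinates `p.1 i = xⁱ` and fibre coordinates
`p.2 J = u_J`, one for each (unordered) multi-index `J`, which is given by its multiplicities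
`J i = #i`. It carries the product topology. -/
abbrev Jet (n : ℕ) : Type := (Fin n → ℝ) × ((Fin n → ℕ) → ℝ)

/-- The differential order `|J|` of a multi-index. -/
def deg {n : ℕ} (J : Fin n → ℕ) : ℕ := ∑ i, J i

/-- The binomial coefficient `(#J)! / ((#K)! (#(J/K))!)` of multi-indices `K ⊆ J`, where
`(#J)!` is the product of the factorials of the multiplicities. -/
def multiBinom {n : ℕ} (J K : Fin n → ℕ) : ℕ := ∏ i, (J i).choose (K i)

/-- Multi-indices of order at most `k`. -/
abbrev MultiIndexLE (n k : ℕ) : Type := {J : Fin n → ℕ // deg J ≤ k}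

instance instFiniteMultiIndexLE (n k : ℕ) : Finite (MultiIndexLE n k) := by
  refine Set.Finite.subset (Set.finite_Iic (fun _ : Fin n => k)) ?_
  intro J hJ i
  exact (Finset.single_le_sum (f := J) (fun _ _ => Nat.zero_le _) (Finset.mem_univ i)).trans hJ

instance instFintypeMultiIndexLE (n k : ℕ) : Fintype (MultiIndexLE n k) := Fintype.ofFinite _

/-- The jet space of order `k`, with coordinates `x` and `u_J`, `|J| ≤ k`. -/
abbrev FiniteJet (n k : ℕ) : Type := (Fin n → ℝ) × (MultiIndexLE n k → ℝ)

/-- The projection of the infinite jet space to the jet space of order `k`. -/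
def truncate {n : ℕ} (k : ℕ) (p : Jet n) : FiniteJet n k := (p.1, fun J => p.2 J.1)

/-- `f` is a (smooth) differential function of differential order at most `k` on the open set
`U` of jet space: there, it is a smooth function of `x` and of the `u_J` with `|J| ≤ k`. -/
def IsDifferentialFunctionOfOrder {n : ℕ} (U : Set (Jet n)) (k : ℕ) (f : Jet n → ℝ) : Prop :=
  ∃ F : FiniteJet n k → ℝ, ContDiffOn ℝ ∞ F (truncate k '' U) ∧ ∀ p ∈ U, f p = F (truncate k p)

/-- `f` is a differential function on `U`: one of some finite differential order. -/
def IsDifferentialFunction {n : ℕ} (U : Set (Jet n)) (f : Jet n → ℝ) : Prop :=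
  ∃ k, IsDifferentialFunctionOfOrder U k f

/-- The partial derivative with respect to the coordinate `xⁱ`, all `u_J` being held fixed. -/
def partialX {n : ℕ} (i : Fin n) (f : Jet n → ℝ) : Jet n → ℝ :=
  fun p => lineDeriv ℝ f p (Pi.single i 1, 0)

/-- The partial derivative `f_{u_J}` with respect to the jet coordinate `u_J`. -/
def partialU {n : ℕ} (J : Fin n → ℕ) (f : Jet n → ℝ) : Jet n → ℝ :=
  fun p => lineDeriv ℝ f p (0, Pi.single J 1)

/-- The total derivative `D_i f = f_{xⁱ} + ∑_K u_{i,K} f_{u_K}`. For a differential function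
only finitely many terms are nonzero. -/
def totalD {n : ℕ} (i : Fin n) (f : Jet n → ℝ) : Jet n → ℝ :=
  fun p => partialX i f p + ∑ᶠ K : Fin n → ℕ, p.2 (K + Pi.single i 1) * partialU K f p

/-- The iterated total derivative `D_J`, in which each `D_i` occurs `J i` times. -/
def totalDMulti {n : ℕ} (J : Fin n → ℕ) (f : Jet n → ℝ) : Jet n → ℝ :=
  (List.finRange n).foldr (fun i g => (totalD i)^[J i] g) f

/-- The Euler-Lagrange operator `E_u(L) = ∑_J (-1)^|J| D_J (L_{u_J})`. For a differential
function only finitely many terms are nonzero. -/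
def eulerOperator {n : ℕ} (L : Jet n → ℝ) : Jet n → ℝ :=
  fun p => ∑ᶠ J : Fin n → ℕ, (-1 : ℝ) ^ deg J * totalDMulti J (partialU J L) p

/-- `G` is an Euler-Lagrange expression on `U`: `G = E_u(L)` for some differential function `L`. -/
def IsEulerLagrange {n : ℕ} (U : Set (Jet n)) (G : Jet n → ℝ) : Prop :=
  ∃ L : Jet n → ℝ, IsDifferentialFunction U L ∧ ∀ p ∈ U, eulerOperator L p = G p

/-- A variational integrating factor of `G` on `U`: a differential function `W`, not identically
zero, such that `W G = E_u(L)` for some Lagrangian `L`. -/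
def IsVariationalIntegratingFactor {n : ℕ} (U : Set (Jet n)) (G W : Jet n → ℝ) : Prop :=
  IsDifferentialFunction U W ∧ (∃ p ∈ U, W p ≠ 0) ∧ IsEulerLagrange U (fun p => W p * G p)

/-- The space `ℰ` of formal solutions of `G = 0` in `U`: the infinite jets at which `G` and all
its total derivatives vanish. -/
def formalSolutions {n : ℕ} (U : Set (Jet n)) (G : Jet n → ℝ) : Set (Jet n) :=
  {p | p ∈ U ∧ ∀ J : Fin n → ℕ, totalDMulti J G p = 0}

/-- The matrix of the binomially weighted top-order derivatives `binom(i,K; i) G_{u_{i,K}}` of `G`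
at the jet `p`, with rows indexed by the multi-indices `K` of order `N - 1` and columns indexed
by `i`. -/
def topDerivMatrix {n : ℕ} (N : ℕ) (G : Jet n → ℝ) (p : Jet n) :
    Matrix {K : Fin n → ℕ // deg K + 1 = N} (Fin n) ℝ :=
  Matrix.of fun K i =>
    (multiBinom (K.1 + Pi.single i 1) (Pi.single i 1) : ℝ) * partialU (K.1 + Pi.single i 1) G p

/-- `W` is non-constant on the set `E` at its point `p`: it is constant on no neighbourhood
of `p` in `E`. -/
def IsNonconstantOnAt {n : ℕ} (E : Set (Jet n)) (W : Jet n → ℝ) (p : Jet n) : Prop :=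
  ¬ ∃ c : ℝ, ∀ᶠ q in 𝓝[E] p, W q = c

end JetCalculus

end

open JetCalculus

noncomputable section

/-! ### Total derivatives, operators `∑ θ_K D_K`, and self-adjointness of Euler–Lagrange
linearizations. -/

namespace JetCalculus

open Finsupp

/-! Let `A = ∑ G_{u_K} D_K` be the linearization of `G`. Linearizations of Euler–Lagrange
expressions are formally self-adjoint because the Hessian of the Lagrangian is symmetric
(`act_vd_euler`). At a formal solution the linearization of `WG` is `W·A` and its adjoint is `A*∘W`,
since the other terms contain total derivatives of `G`. As `G` and `WG` are both Euler–Lagrange,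
`A∘W = W·A` there (`eval_act_vd_mul`). Commutators with the base coordinates, taken according to a
multi-index `K` of order `N - 1`, reduce `A` to a first-order operator whose first-order
coefficients are `K!` times row `K` of the matrix. Applied to the constant `1`, the commutation
relation says that row `K` annihilates `(D_1 W, …, D_n W)` (`sum_dU_mul_D_eq_zero`). If the rank is
`n` at `p`, it is `n` nearby, and all `D_i W` vanish on `ℰ` near `p`.

It remains to see that such a `W` is locally constant on `ℰ`. This needs `n ≥ 2`: for `n = 1` it
fails for first integrals, such as `u_x` for `u_xx = 0`. Full rank makes the principal symbol `s` of
`G` nonzero, so the `D_I G` have independent differentials, and a formal solution of finite order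
extends to one of infinite order (`exists_solution_truncate_eq`). Lagrange multipliers then show
that a function vanishing on `ℰ` has its differential in the span of the `d(D_I G)`
(`exists_multipliers`).

Applied to `D_i W`, this makes `ξ_i w` a multiple of `s`, where `w` is the top-order part of the
vertical differential of `W`. With two different variables `ξ_i` available, `w` itself is a multiple
of `s` (`exists_eq_mul_of_X_mul_eq_mul`). Subtracting a combination of the `d(D_I G)` lowers the
order, and the process repeats until nothing is left (`evPoly_mem_range_prolongation`). Hence `dW`
vanishes on the tangent spaces of the level sets that cut out `ℰ` at finite order, and `W` is
locally constant (`eventually_eq_of_fderiv_eq_zero_on_ker`). -/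

theorem multiIndex_induction {σ : Type*} {motive : (σ →₀ ℕ) → Prop} (zero : motive 0)
    (add_single : ∀ K i, motive K → motive (K + single i 1)) (K : σ →₀ ℕ) : motive K := by
  induction K using Finsupp.induction with
  | zero => exact zero
  | single_add a b f _ _ ih =>
    have (b : ℕ) : motive (f + single a b) := by
      induction b with
      | zero => simpa using ih
      | succ b hb =>
        have := add_single _ a hb
        rwa [add_assoc, ← single_add] at this
    rw [add_comm]
    exact this b

/-- A commutative algebra with the partial derivatives and the coordinate functions of a jet
space. -/
structure JetAlgebra (n : ℕ) (A : Type*) [CommRing A] [Algebra ℝ A] where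
  /-- the derivations `∂/∂xⁱ` -/
  dX : Fin n → Derivation ℝ A A
  /-- the derivations `∂/∂u_K` -/
  dU : (Fin n →₀ ℕ) → Derivation ℝ A A
  /-- the base coordinates -/
  x : Fin n → A
  /-- the fibre coordinates -/
  u : (Fin n →₀ ℕ) → A
  dX_dX : ∀ i j f, dX i (dX j f) = dX j (dX i f)
  dX_dU : ∀ i K f, dX i (dU K f) = dU K (dX i f)
  dU_dU : ∀ J K f, dU J (dU K f) = dU K (dU J f)
  dX_x : ∀ i j, dX i (x j) = if i = j then 1 else 0
  dU_x : ∀ K j, dU K (x j) = 0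
  dX_u : ∀ i K, dX i (u K) = 0
  dU_u : ∀ J K, dU J (u K) = if J = K then 1 else 0
  finite_dU : ∀ f, (Function.support fun K => dU K f).Finite

namespace JetAlgebra

variable {n : ℕ} {A : Type*} [CommRing A] [Algebra ℝ A] (S : JetAlgebra n A)

/-- The vertical differential `∑_K f_{u_K} du_K`. -/
def vd : A →+ ((Fin n →₀ ℕ) →₀ A) where
  toFun f := ofSupportFinite (fun K => S.dU K f) (S.finite_dU f)
  map_zero' := by ext K; simp [ofSupportFinite]
  map_add' f g := by
    ext K
    rw [Finsupp.add_apply]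
    exact map_add (S.dU K) f g

@[simp] theorem vd_apply (f : A) (K : Fin n →₀ ℕ) : S.vd f K = S.dU K f := rfl

/-- The freedom in `s` allows the sums for `f`, `g`, `f + g` and `f * g` to run over one common set.
-/
theorem sum_u_mul_eq (i : Fin n) (f : A) {s : Finset (Fin n →₀ ℕ)} (hs : (S.vd f).support ⊆ s) :
    ((S.vd f).sum fun K c => S.u (K + single i 1) * c)
      = ∑ K ∈ s, S.u (K + single i 1) * S.dU K f :=
  sum_of_support_subset _ hs _ (by simp)

/-- The total derivative `D_i = ∂_{x^i} + ∑_K u_{i,K} ∂_{u_K}`. -/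
def D (i : Fin n) : Derivation ℝ A A :=
  Derivation.mk'
    { toFun := fun f => S.dX i f + (S.vd f).sum fun K c => S.u (K + single i 1) * c
      map_add' := fun f g => by
        classical
        rw [S.sum_u_mul_eq i f (Finset.subset_union_left (s₂ := (S.vd g).support)),
          S.sum_u_mul_eq i g (Finset.subset_union_right (s₁ := (S.vd f).support)),
          S.sum_u_mul_eq i (f + g) (s := (S.vd f).support ∪ (S.vd g).support)
            (by rw [map_add]; exact support_add)]
        simp only [map_add (S.dX i), map_add (S.dU _), mul_add, Finset.sum_add_distrib]
        ring
      map_smul' := fun r f => by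
        rw [S.sum_u_mul_eq i f subset_rfl, S.sum_u_mul_eq i (r • f) (s := (S.vd f).support)
          (fun K hK => by
            rw [mem_support_iff] at hK ⊢
            contrapose! hK
            rw [vd_apply] at hK ⊢
            rw [Derivation.map_smul, hK, smul_zero])]
        simp [Finset.smul_sum] }
    (fun f g => by
      classical
      change S.dX i (f * g) + _ = f • (S.dX i g + _) + g • (S.dX i f + _)
      rw [S.sum_u_mul_eq i f (Finset.subset_union_left (s₂ := (S.vd g).support)),
        S.sum_u_mul_eq i g (Finset.subset_union_right (s₁ := (S.vd f).support)),
        S.sum_u_mul_eq i (f * g) (s := (S.vd f).support ∪ (S.vd g).support) (fun K hK => by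
          rw [mem_support_iff] at hK
          by_contra h
          simp only [Finset.mem_union, not_or, notMem_support_iff, vd_apply] at h
          apply hK
          simp [h.1, h.2])]
      simp only [Derivation.leibniz, smul_eq_mul, mul_add, Finset.sum_add_distrib, Finset.mul_sum]
      have h1 (a b c : A) : a * (b * c) = b * (a * c) := by ring
      simp only [h1]
      ring)

theorem D_eq (i : Fin n) (f : A) {s : Finset (Fin n →₀ ℕ)} (hs : (S.vd f).support ⊆ s) :
    S.D i f = S.dX i f + ∑ K ∈ s, S.u (K + single i 1) * S.dU K f := by
  rw [← S.sum_u_mul_eq i f hs]; rfl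

theorem support_vd_dX (i : Fin n) (f : A) : (S.vd (S.dX i f)).support ⊆ (S.vd f).support := by
  intro K hK
  rw [mem_support_iff] at hK ⊢
  contrapose! hK
  rw [vd_apply] at hK ⊢
  rw [← S.dX_dU, hK, map_zero]

theorem support_vd_dU (J : Fin n →₀ ℕ) (f : A) :
    (S.vd (S.dU J f)).support ⊆ (S.vd f).support := by
  intro K hK
  rw [mem_support_iff] at hK ⊢
  contrapose! hK
  rw [vd_apply] at hK ⊢
  rw [S.dU_dU, hK, map_zero]

/-- Only the coefficients `u_{J,i}` of `D_i` fail to commute with `∂_{u_K}`, so the commutator is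
`∂_{u_J}` for the `J` with `K = J + i`, or zero. A sum with a condition avoids the truncated
subtraction `K - i`. -/
theorem dU_D (K : Fin n →₀ ℕ) (i : Fin n) (f : A) :
    S.dU K (S.D i f) = S.D i (S.dU K f)
      + ∑ J ∈ (S.vd f).support, if K = J + single i 1 then S.dU J f else 0 := by
  rw [S.D_eq i f subset_rfl, S.D_eq i _ (S.support_vd_dU K f)]
  simp only [map_add, map_sum, Derivation.leibniz, S.dU_u, smul_eq_mul, Finset.sum_add_distrib,
    mul_ite, mul_one, mul_zero, S.dX_dU, S.dU_dU K]
  ring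

theorem dU_D_add_single (K : Fin n →₀ ℕ) (i : Fin n) (f : A) :
    S.dU (K + single i 1) (S.D i f) = S.D i (S.dU (K + single i 1) f) + S.dU K f := by
  rw [dU_D]
  congr 1
  simp only [add_left_inj]
  rw [Finset.sum_ite_eq]
  split_ifs with h
  · rfl
  · exact (notMem_support_iff.1 h).symm

theorem dU_D_of_eq_zero (K : Fin n →₀ ℕ) (i : Fin n) (f : A) (hK : K i = 0) :
    S.dU K (S.D i f) = S.D i (S.dU K f) := by
  rw [dU_D, Finset.sum_eq_zero, add_zero]
  intro J _
  rw [if_neg]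
  rintro rfl
  simp at hK

theorem D_u (i : Fin n) (K : Fin n →₀ ℕ) : S.D i (S.u K) = S.u (K + single i 1) := by
  rw [S.D_eq i _ (s := {K})]
  · simp [S.dX_u, S.dU_u]
  · intro J hJ
    rw [mem_support_iff, vd_apply, S.dU_u] at hJ
    by_contra h
    exact hJ (if_neg (by simpa using h))

theorem D_x (i j : Fin n) : S.D i (S.x j) = if i = j then 1 else 0 := by
  rw [S.D_eq i _ (s := ∅)]
  · simp [S.dX_x]
  · intro J hJ
    simp [S.dU_x] at hJ

theorem D_D (i j : Fin n) (f : A) : S.D i (S.D j f) = S.D j (S.D i f) := by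
  -- Fully expanded, each term is symmetric in `i` and `j` or is exchanged with another one.
  have key (i j : Fin n) : S.D i (S.D j f) = S.dX i (S.dX j f)
      + ∑ J ∈ (S.vd f).support, S.u (J + single i 1) * S.dU J (S.dX j f)
      + ∑ K ∈ (S.vd f).support, S.u (K + single j 1 + single i 1) * S.dU K f
      + ∑ K ∈ (S.vd f).support, S.u (K + single j 1) * S.dU K (S.dX i f)
      + ∑ K ∈ (S.vd f).support, ∑ J ∈ (S.vd f).support,
          S.u (K + single j 1) * (S.u (J + single i 1) * S.dU J (S.dU K f)) := by
    rw [S.D_eq j f subset_rfl]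
    simp only [map_add, map_sum, Derivation.leibniz, D_u, smul_eq_mul, Finset.sum_add_distrib]
    rw [S.D_eq i _ (S.support_vd_dX j f)]
    have h (K : Fin n →₀ ℕ) := S.D_eq i _ (S.support_vd_dU K f)
    simp only [h, mul_add, Finset.sum_add_distrib, Finset.mul_sum, S.dX_dU]
    have h1 (a b : A) : a * b = b * a := mul_comm a b
    simp only [fun K => mul_comm (S.dU K f) (S.u (K + single j 1 + single i 1))]
    ring
  rw [key i j, key j i, S.dX_dX i j, Finset.sum_comm]
  simp only [add_right_comm _ (single i 1) (single j 1), S.dU_dU,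
    mul_left_comm (S.u (_ + single i 1))]
  ring

/-- The iterated total derivative `D_K`. -/
def DD (K : Fin n →₀ ℕ) : Module.End ℝ A :=
  ((List.finRange n).map fun i => (S.D i : Module.End ℝ A) ^ K i).prod

theorem DD_zero (f : A) : S.DD 0 f = f := by
  have : S.DD 0 = 1 := List.prod_eq_one (by simp)
  rw [this]; rfl

theorem commute_D (i j : Fin n) : Commute (S.D i : Module.End ℝ A) (S.D j : Module.End ℝ A) :=
  LinearMap.ext fun f => S.D_D i j f

theorem DD_add_single (K : Fin n →₀ ℕ) (i : Fin n) (f : A) :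
    S.DD (K + single i 1) f = S.D i (S.DD K f) := by
  have key (l : List (Fin n)) :
      (l.map fun j => (S.D j : Module.End ℝ A) ^ (K + single i 1 : Fin n →₀ ℕ) j).prod
        = (S.D i : Module.End ℝ A) ^ l.count i
          * (l.map fun j => (S.D j : Module.End ℝ A) ^ K j).prod := by
    induction l with
    | nil => simp
    | cons j l ih =>
      rw [List.map_cons, List.prod_cons, ih, List.map_cons, List.prod_cons, ← mul_assoc,
        ← mul_assoc]
      congr 1
      by_cases h : j = i
      · subst h
        simp only [Finsupp.add_apply, single_eq_same, List.count_cons_self]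
        rw [← pow_add, ← pow_add]
        congr 1; ring
      · simp only [Finsupp.add_apply, single_eq_of_ne h, add_zero,
          List.count_cons_of_ne h]
        exact ((S.commute_D j i).pow_pow _ _).eq
  have h1 : (List.finRange n).count i = 1 :=
    List.count_eq_one_of_mem (List.nodup_finRange n) (List.mem_finRange i)
  unfold DD
  rw [key, h1, pow_one]
  rfl

theorem DD_single (i : Fin n) (f : A) : S.DD (single i 1) f = S.D i f := by
  rw [← zero_add (single i 1), DD_add_single, DD_zero]

theorem DD_D (K : Fin n →₀ ℕ) (i : Fin n) (f : A) : S.DD K (S.D i f) = S.D i (S.DD K f) := by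
  induction K using multiIndex_induction with
  | zero => simp [DD_zero]
  | add_single K j ih => rw [DD_add_single, ih, DD_add_single, D_D]

/-- Composition of a differential operator `∑ θ_K D_K` with `D_i` from the left. -/
def leftD (i : Fin n) : ((Fin n →₀ ℕ) →₀ A) →+ ((Fin n →₀ ℕ) →₀ A) :=
  mapRange.addMonoidHom (S.D i : A →+ A) + mapDomain.addMonoidHom (· + single i 1)

theorem leftD_apply_add_single (i : Fin n) (θ : (Fin n →₀ ℕ) →₀ A) (K : Fin n →₀ ℕ) :
    S.leftD i θ (K + single i 1) = S.D i (θ (K + single i 1)) + θ K := by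
  change S.D i (θ (K + single i 1)) + mapDomain (· + single i 1) θ (K + single i 1) = _
  rw [mapDomain_apply (f := (· + single i 1)) (add_left_injective _)]

theorem leftD_apply_of_eq_zero (i : Fin n) (θ : (Fin n →₀ ℕ) →₀ A) (K : Fin n →₀ ℕ)
    (hK : K i = 0) : S.leftD i θ K = S.D i (θ K) := by
  change S.D i (θ K) + mapDomain (· + single i 1) θ K = _
  rw [mapDomain_of_notMem_range, add_zero]
  rintro ⟨J, rfl⟩
  simp at hK

theorem eq_add_single {i : Fin n} {K : Fin n →₀ ℕ} (hK : K i ≠ 0) :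
    ∃ J, K = J + single i 1 := by
  refine ⟨K - single i 1, (tsub_add_cancel_of_le ?_).symm⟩
  rw [single_le_iff]
  omega

/-- The commutator formula read as an identity of operators: linearization turns `D_i` into
composition with `D_i`. All later facts about the linearizations of the `D_I G` come from this by
induction. -/
theorem vd_D (i : Fin n) (f : A) : S.vd (S.D i f) = S.leftD i (S.vd f) := by
  ext K
  by_cases hK : K i = 0
  · rw [leftD_apply_of_eq_zero _ _ _ _ hK, vd_apply, dU_D_of_eq_zero _ _ _ _ hK, vd_apply]
  · obtain ⟨J, rfl⟩ := eq_add_single hK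
    rw [leftD_apply_add_single, vd_apply, dU_D_add_single, vd_apply, vd_apply]

/-- The action of the differential operator `∑ θ_K D_K`. -/
def act (θ : (Fin n →₀ ℕ) →₀ A) (f : A) : A := θ.sum fun K c => c * S.DD K f

/-- The action of the formal adjoint of the differential operator `∑ θ_K D_K`. -/
def adj (θ : (Fin n →₀ ℕ) →₀ A) (f : A) : A :=
  θ.sum fun K c => (-1 : ℤ) ^ K.degree • S.DD K (c * f)

theorem act_eq {θ : (Fin n →₀ ℕ) →₀ A} {s : Finset (Fin n →₀ ℕ)} (hs : θ.support ⊆ s) (f : A) :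
    S.act θ f = ∑ K ∈ s, θ K * S.DD K f :=
  sum_of_support_subset _ hs _ (by simp)

theorem adj_eq {θ : (Fin n →₀ ℕ) →₀ A} {s : Finset (Fin n →₀ ℕ)} (hs : θ.support ⊆ s) (f : A) :
    S.adj θ f = ∑ K ∈ s, (-1 : ℤ) ^ K.degree • S.DD K (θ K * f) :=
  sum_of_support_subset _ hs _ (by simp)

theorem act_add (θ η : (Fin n →₀ ℕ) →₀ A) (f : A) : S.act (θ + η) f = S.act θ f + S.act η f :=
  sum_add_index' (by simp) (by intros; ring)

theorem adj_add (θ η : (Fin n →₀ ℕ) →₀ A) (f : A) : S.adj (θ + η) f = S.adj θ f + S.adj η f :=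
  sum_add_index' (by simp) (by intros; simp [add_mul])

/-- `act` as an additive map in the operator. -/
def actHom (f : A) : ((Fin n →₀ ℕ) →₀ A) →+ A where
  toFun θ := S.act θ f
  map_zero' := sum_zero_index
  map_add' θ η := S.act_add θ η f

/-- `adj` as an additive map in the operator. -/
def adjHom (f : A) : ((Fin n →₀ ℕ) →₀ A) →+ A where
  toFun θ := S.adj θ f
  map_zero' := sum_zero_index
  map_add' θ η := S.adj_add θ η f

theorem degree_add_single (K : Fin n →₀ ℕ) (i : Fin n) :
    (K + single i 1).degree = K.degree + 1 := by
  rw [map_add, degree_single]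

theorem act_leftD (i : Fin n) (θ : (Fin n →₀ ℕ) →₀ A) (f : A) :
    S.act (S.leftD i θ) f = S.D i (S.act θ f) := by
  change S.act (mapRange (S.D i) (map_zero _) θ + mapDomain (· + single i 1) θ) f = _
  rw [act_add]
  unfold act
  rw [sum_mapRange_index (by simp), sum_mapDomain_index (by simp) (by intros; ring),
    ← sum_add]
  simp only [Finsupp.sum, map_sum]
  refine Finset.sum_congr rfl fun K _ => ?_
  rw [Derivation.leibniz, DD_add_single, smul_eq_mul, smul_eq_mul]
  ring

/-- The adjoint reverses composition, and `D_i` has adjoint `-D_i`. -/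
theorem adj_leftD (i : Fin n) (θ : (Fin n →₀ ℕ) →₀ A) (f : A) :
    S.adj (S.leftD i θ) f = - S.adj θ (S.D i f) := by
  change S.adj (mapRange (S.D i) (map_zero _) θ + mapDomain (· + single i 1) θ) f = _
  rw [adj_add]
  unfold adj
  rw [sum_mapRange_index (by simp), sum_mapDomain_index (by simp) (by intros; simp [add_mul]),
    ← sum_add]
  simp only [Finsupp.sum]
  rw [← Finset.sum_neg_distrib]
  refine Finset.sum_congr rfl fun K _ => ?_
  rw [DD_add_single, degree_add_single, pow_succ, mul_neg_one, neg_smul, ← sub_eq_add_neg,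
    ← smul_sub, ← smul_neg, ← DD_D, ← map_sub, ← map_neg, Derivation.leibniz]
  congr 2
  simp only [smul_eq_mul]
  ring

theorem act_vd_DD (K : Fin n →₀ ℕ) (h f : A) :
    S.act (S.vd (S.DD K h)) f = S.DD K (S.act (S.vd h) f) := by
  induction K using multiIndex_induction with
  | zero => simp [DD_zero]
  | add_single K i ih => rw [DD_add_single, vd_D, act_leftD, ih, DD_add_single]

theorem adj_vd_DD (K : Fin n →₀ ℕ) (h f : A) :
    S.adj (S.vd (S.DD K h)) f = (-1 : ℤ) ^ K.degree • S.adj (S.vd h) (S.DD K f) := by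
  induction K using multiIndex_induction generalizing f with
  | zero => simp [DD_zero]
  | add_single K i ih =>
    rw [DD_add_single, vd_D, adj_leftD, ih, DD_add_single, degree_add_single, DD_D, pow_succ,
      mul_neg_one, neg_smul]

/-- The Euler–Lagrange operator. -/
def euler (L : A) : A := (S.vd L).sum fun K c => (-1 : ℤ) ^ K.degree • S.DD K c

/-- The sign `(-1)^|J|` of the Euler operator cancels that of the adjoint of `D_J`. The two sides
are then double sums over `(J, K)` with coefficients `L_{u_J u_K}`, exchanged by swapping `J` and
`K`. -/
theorem act_vd_euler (L f : A) : S.act (S.vd (S.euler L)) f = S.adj (S.vd (S.euler L)) f := by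
  have h1 : S.vd (S.euler L) = ∑ J ∈ (S.vd L).support,
      (-1 : ℤ) ^ J.degree • S.vd (S.DD J (S.dU J L)) := by
    simp only [euler, Finsupp.sum, map_sum, map_zsmul, vd_apply]
  change S.actHom f (S.vd (S.euler L)) = S.adjHom f (S.vd (S.euler L))
  rw [h1]
  simp only [map_sum, map_zsmul]
  change ∑ J ∈ (S.vd L).support, (-1 : ℤ) ^ J.degree • S.act (S.vd (S.DD J (S.dU J L))) f
    = ∑ J ∈ (S.vd L).support, (-1 : ℤ) ^ J.degree • S.adj (S.vd (S.DD J (S.dU J L))) f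
  simp only [act_vd_DD, adj_vd_DD, smul_smul, ← mul_pow, neg_mul_neg, one_mul, one_pow, one_smul]
  simp only [S.act_eq (S.support_vd_dU _ L), S.adj_eq (S.support_vd_dU _ L), map_sum,
    Finset.smul_sum, vd_apply]
  rw [Finset.sum_comm]
  refine Finset.sum_congr rfl fun J _ => Finset.sum_congr rfl fun K _ => ?_
  rw [S.dU_dU]

end JetAlgebra

end JetCalculus

/-! ### The relation between the matrix rows and the total derivatives of an integrating factor. -/

namespace JetCalculus

open Finsupp

namespace JetAlgebra

variable {n : ℕ} {A : Type*} [CommRing A]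

/-- The derivative of the symbol of a differential operator `∑ θ_K D_K`, which is its commutator
with multiplication by `x^j`. -/
def symbolDeriv (j : Fin n) (θ : (Fin n →₀ ℕ) →₀ A) : (Fin n →₀ ℕ) →₀ A :=
  θ.sum fun K c => single (K - single j 1) (K j • c)

theorem symbolDeriv_apply (j : Fin n) (θ : (Fin n →₀ ℕ) →₀ A) (L : Fin n →₀ ℕ) :
    symbolDeriv j θ L = (L j + 1) • θ (L + single j 1) := by
  rw [symbolDeriv, Finsupp.sum_apply, Finsupp.sum, Finset.sum_eq_single (L + single j 1)]
  · simp
  · intro K _ hK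
    rw [single_apply]
    split_ifs with h
    · by_cases hj : K j = 0
      · simp [hj]
      · exact absurd (by rw [← h, tsub_add_cancel_of_le (single_le_iff.2 (by omega))]) hK
    · rfl
  · intro h
    rw [notMem_support_iff.1 h]
    simp

variable [Algebra ℝ A] (S : JetAlgebra n A)

theorem DD_x_mul (j : Fin n) (K : Fin n →₀ ℕ) (f : A) :
    S.DD K (S.x j * f) = S.x j * S.DD K f + K j • S.DD (K - single j 1) f := by
  induction K using multiIndex_induction with
  | zero => simp [DD_zero]
  | add_single K i ih =>
    rw [DD_add_single, ih, map_add, Derivation.leibniz, D_x, DD_add_single, map_nsmul,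
      ← DD_add_single, ← DD_add_single, smul_eq_mul, smul_eq_mul]
    by_cases hij : i = j
    · subst hij
      rw [add_tsub_cancel_right, if_pos rfl, mul_one, Finsupp.add_apply, single_eq_same, add_smul,
        one_smul]
      by_cases hK : K i = 0
      · simp [hK]
      · rw [tsub_add_cancel_of_le (single_le_iff.2 (by omega))]
        ring
    · have h2 : (K + single i 1 : Fin n →₀ ℕ) j = K j := by
        rw [Finsupp.add_apply, single_eq_of_ne' hij, add_zero]
      rw [if_neg hij, mul_zero, add_zero, h2]
      by_cases hK : K j = 0
      · simp [hK]
      · rw [tsub_add_eq_add_tsub (single_le_iff.2 (by omega))]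

theorem act_symbolDeriv (j : Fin n) (θ : (Fin n →₀ ℕ) →₀ A) (f : A) :
    S.act (symbolDeriv j θ) f = S.act θ (S.x j * f) - S.x j * S.act θ f := by
  have h1 : S.act (symbolDeriv j θ) f
      = θ.sum fun K c => S.act (single (K - single j 1) (K j • c)) f :=
    map_finsuppSum (S.actHom f) θ _
  have h2 (K : Fin n →₀ ℕ) (c : A) : S.act (single K c) f = c * S.DD K f :=
    sum_single_index (by simp)
  rw [h1]
  simp only [h2]
  simp only [act, Finsupp.sum]
  rw [Finset.mul_sum, ← Finset.sum_sub_distrib]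
  refine Finset.sum_congr rfl fun K _ => ?_
  rw [DD_x_mul, smul_mul_assoc, ← mul_smul_comm]
  ring

/-- The product of the factorials of the multiplicities of a multi-index. -/
def multiFactorial (K : Fin n →₀ ℕ) : ℕ := ∏ i, (K i).factorial

theorem multiFactorial_add_single (K : Fin n →₀ ℕ) (i : Fin n) :
    multiFactorial (K + single i 1) = (K i + 1) * multiFactorial K := by
  unfold multiFactorial
  rw [← Finset.mul_prod_erase _ _ (Finset.mem_univ i), ← Finset.mul_prod_erase _ _
    (Finset.mem_univ i), ← mul_assoc]
  congr 1
  · simp [Nat.factorial_succ]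
  · refine Finset.prod_congr rfl fun j hj => ?_
    rw [Finsupp.add_apply, single_eq_of_ne (Finset.ne_of_mem_erase hj), add_zero]

theorem multiFactorial_pos (K : Fin n →₀ ℕ) : 0 < multiFactorial K :=
  Finset.prod_pos fun _ _ => Nat.factorial_pos _

/-- The ideal generated by all `D_I G` is stable under total derivatives. It vanishes at formal
solutions, so terms with a factor `G` may be dropped even inside `D_K`. -/
theorem DD_mul_mem (G h : A) (K : Fin n →₀ ℕ) :
    S.DD K (G * h) ∈ Ideal.span (Set.range fun I => S.DD I G) := by
  induction K using multiIndex_induction with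
  | zero =>
    rw [DD_zero]
    exact Ideal.mul_mem_right _ _ (Ideal.subset_span ⟨0, S.DD_zero G⟩)
  | add_single K i ih =>
    rw [DD_add_single]
    refine Submodule.span_induction (p := fun f _ => S.D i f ∈ Ideal.span _) ?_ ?_ ?_ ?_ ih
    · rintro _ ⟨I, rfl⟩
      exact Ideal.subset_span ⟨I + single i 1, S.DD_add_single I i G⟩
    · simp
    · intro f g _ _ hf hg
      rw [map_add]
      exact Ideal.add_mem _ hf hg
    · intro a f hf' hf
      rw [smul_eq_mul, Derivation.leibniz]
      exact Ideal.add_mem _ (Ideal.mul_mem_left _ _ hf) (Ideal.mul_mem_right _ _ hf')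

/-- The multiplier condition: an integrating factor `W` of `G` between self-adjoint expressions
commutes with the linearization of `G` on solutions. -/
theorem eval_act_vd_mul {G W : A} (hG : ∀ f, S.act (S.vd G) f = S.adj (S.vd G) f)
    (hWG : ∀ f, S.act (S.vd (W * G)) f = S.adj (S.vd (W * G)) f) (ev : A →ₐ[ℝ] ℝ)
    (hev : ∀ K, ev (S.DD K G) = 0) (f : A) :
    ev (S.act (S.vd G) (W * f)) = ev W * ev (S.act (S.vd G) f) := by
  classical
  have hzero (K : Fin n →₀ ℕ) (h : A) : ev (S.DD K (G * h)) = 0 := by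
    have : Ideal.span (Set.range fun I => S.DD I G) ≤ RingHom.ker ev := by
      rw [Ideal.span_le]
      rintro _ ⟨I, rfl⟩
      exact hev I
    exact this (S.DD_mul_mem G h K)
  set s := (S.vd G).support ∪ (S.vd W).support with hs
  have hsG : (S.vd G).support ⊆ s := Finset.subset_union_left
  have hsWG : (S.vd (W * G)).support ⊆ s := by
    intro K hK
    rw [mem_support_iff] at hK
    by_contra h
    simp only [hs, Finset.mem_union, not_or, notMem_support_iff, vd_apply] at h
    apply hK
    simp [h.1, h.2]
  -- `d(WG) = W dG + G dW`, and `G` vanishes at the point.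
  have h1 : ev (S.act (S.vd (W * G)) f) = ev W * ev (S.act (S.vd G) f) := by
    rw [S.act_eq hsWG, S.act_eq hsG, ← map_mul, Finset.mul_sum, map_sum, map_sum]
    refine Finset.sum_congr rfl fun K _ => ?_
    have hG0 : ev G = 0 := by simpa [DD_zero] using hev 0
    simp only [vd_apply, Derivation.leibniz, smul_eq_mul, map_mul, map_add, hG0]
    ring
  -- In the adjoint, `W` stays under `D_K` and is absorbed into the argument.
  have h2 : ev (S.adj (S.vd (W * G)) f) = ev (S.adj (S.vd G) (W * f)) := by
    rw [S.adj_eq hsWG, S.adj_eq hsG, map_sum, map_sum]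
    refine Finset.sum_congr rfl fun K _ => ?_
    have h3 : S.vd (W * G) K * f = S.vd G K * (W * f) + G * (S.dU K W * f) := by
      simp only [vd_apply, Derivation.leibniz, smul_eq_mul]
      ring
    rw [h3, map_add, smul_add, map_add, map_zsmul ev _ (S.DD K (G * _)), hzero, smul_zero,
      add_zero]
  rw [hG, ← h2, ← hWG, h1]

/-- Each commutator with some `x^j` lowers the order by one and preserves the commutation with `W`.
After `K` has been used up, an operator `θ_0 + ∑ θ_i D_i` remains, for which commuting with `W`
means `∑ θ_i D_i W = 0`. -/
theorem sum_dU_mul_D_eq_zero {G W : A} (hG : ∀ f, S.act (S.vd G) f = S.adj (S.vd G) f)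
    (hWG : ∀ f, S.act (S.vd (W * G)) f = S.adj (S.vd (W * G)) f) (ev : A →ₐ[ℝ] ℝ)
    (hev : ∀ K, ev (S.DD K G) = 0) {K : Fin n →₀ ℕ}
    (hK : ∀ J : Fin n →₀ ℕ, K.degree + 1 < J.degree → S.dU J G = 0) :
    ∑ i, (K i + 1 : ℝ) * ev (S.dU (K + single i 1) G) * ev (S.D i W) = 0 := by
  -- `θ` is the `K`-th derivative of the symbol; the factorials on both sides express its
  -- coefficients without division.
  have key (K : Fin n →₀ ℕ) : ∃ θ : (Fin n →₀ ℕ) →₀ A,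
      (∀ f, ev (S.act θ (W * f)) = ev W * ev (S.act θ f)) ∧
      ∀ L, multiFactorial L • θ L = multiFactorial (L + K) • S.dU (L + K) G := by
    induction K using multiIndex_induction with
    | zero => exact ⟨S.vd G, S.eval_act_vd_mul hG hWG ev hev, by simp⟩
    | add_single K j ih =>
      obtain ⟨θ, h1, h2⟩ := ih
      refine ⟨symbolDeriv j θ, fun f => ?_, fun L => ?_⟩
      · rw [act_symbolDeriv, act_symbolDeriv, mul_left_comm, map_sub, map_sub, h1, map_mul,
          map_mul, h1]
        ring
      · rw [symbolDeriv_apply, smul_smul, mul_comm, ← multiFactorial_add_single, h2,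
          add_assoc, add_comm (single j 1) K]
  obtain ⟨θ, h1, h2⟩ := key K
  have hθ (L : Fin n →₀ ℕ) (hL : 1 < L.degree) : θ L = 0 := by
    have h3 := h2 L
    rw [hK (L + K) (by rw [map_add]; omega), smul_zero, ← Nat.cast_smul_eq_nsmul ℝ] at h3
    have h4 : (multiFactorial L : ℝ) ≠ 0 := by exact_mod_cast (multiFactorial_pos L).ne'
    exact (smul_eq_zero_iff_right h4).1 h3
  have hθ1 (i : Fin n) : θ (single i 1)
      = (multiFactorial K * (K i + 1)) • S.dU (K + single i 1) G := by
    have h3 := h2 (single i 1)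
    have h4 : multiFactorial (single i 1 : Fin n →₀ ℕ) = 1 := by
      have := multiFactorial_add_single (0 : Fin n →₀ ℕ) i
      simpa [multiFactorial] using this
    rw [h4, one_smul, add_comm, multiFactorial_add_single] at h3
    rw [h3, mul_comm]
  have hsum (f : A) : S.act θ f = θ 0 * f + ∑ i, θ (single i 1) * S.D i f := by
    classical
    rw [S.act_eq (s := insert 0 (Finset.univ.image fun i => single i 1)), Finset.sum_insert,
      Finset.sum_image, DD_zero]
    · simp only [DD_single]
    · intro i _ j _ hij
      exact (single_left_inj one_ne_zero).1 hij
    · simp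
    · intro L hL
      have h5 : ¬ 1 < L.degree := fun h => (mem_support_iff.1 hL) (hθ L h)
      by_cases h0 : L = 0
      · simp [h0]
      · obtain ⟨i, hi⟩ := Finsupp.ne_iff.1 h0
        obtain ⟨J, rfl⟩ := eq_add_single hi
        rw [degree_add_single] at h5
        have : J = 0 := (degree_eq_zero_iff J).1 (by omega)
        simp [this]
  -- On the constant `1`, the zeroth-order terms cancel.
  have h3 := h1 1
  rw [hsum, hsum] at h3
  simp only [mul_one, map_add, map_mul, map_sum, Derivation.map_one_eq_zero, mul_zero,
    Finset.sum_const_zero, add_zero] at h3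
  have h4 : ∑ i, ev (θ (single i 1)) * ev (S.D i W) = 0 := by
    linarith
  simp only [hθ1, map_nsmul] at h4
  have h5 : (multiFactorial K : ℝ) ≠ 0 := by exact_mod_cast (multiFactorial_pos K).ne'
  refine (mul_eq_zero.1 (?_ : (multiFactorial K : ℝ) * _ = 0)).resolve_left h5
  rw [← h4, Finset.mul_sum]
  refine Finset.sum_congr rfl fun i _ => ?_
  rw [nsmul_eq_mul]
  push_cast
  ring

end JetAlgebra

end JetCalculus

/-! ### Principal symbols and the division argument. -/

namespace JetCalculus

open Finsupp MvPolynomial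

section Homogeneous

variable {σ R : Type*} [CommRing R]

theorem homogeneousComponent_mul_of_isHomogeneous {s : MvPolynomial σ R} {N : ℕ}
    (hs : s.IsHomogeneous N) (p : MvPolynomial σ R) (d : ℕ) :
    homogeneousComponent (d + N) (p * s) = homogeneousComponent d p * s := by
  have h1 : p * s = ∑ m ∈ Finset.range (p.totalDegree + 1), homogeneousComponent m p * s := by
    rw [← Finset.sum_mul, sum_homogeneousComponent]
  rw [h1, map_sum]
  have h2 (m : ℕ) : homogeneousComponent (d + N) (homogeneousComponent m p * s)
      = if d = m then homogeneousComponent m p * s else 0 := by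
    have := homogeneousComponent_of_mem (m := d + N)
      ((homogeneousComponent_isHomogeneous m p).mul hs)
    simpa only [add_left_inj] using this
  simp only [h2]
  rw [Finset.sum_ite_eq]
  split_ifs with h
  · rfl
  · rw [Finset.mem_range, not_lt] at h
    rw [homogeneousComponent_eq_zero _ _ (by omega), zero_mul]

theorem homogeneousComponent_mul_of_lt {s : MvPolynomial σ R} {N : ℕ}
    (hs : s.IsHomogeneous N) (p : MvPolynomial σ R) {d : ℕ} (hd : d < N) :
    homogeneousComponent d (p * s) = 0 := by
  have h1 : p * s = ∑ m ∈ Finset.range (p.totalDegree + 1), homogeneousComponent m p * s := by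
    rw [← Finset.sum_mul, sum_homogeneousComponent]
  rw [h1, map_sum]
  refine Finset.sum_eq_zero fun m _ => ?_
  rw [homogeneousComponent_of_mem ((homogeneousComponent_isHomogeneous m p).mul hs),
    if_neg (by omega)]

/-- Cancelling `s` gives `X_j a = X_i b`. As `X_i` is prime and does not divide `X_j`, it divides
`a` and can be cancelled from `X_i w = a s`. Here at least two independent variables are essential.
-/
theorem exists_eq_mul_of_X_mul_eq_mul [IsDomain R] {i j : σ} (hij : i ≠ j)
    {s w a b : MvPolynomial σ R} (hs : s ≠ 0) (ha : X i * w = a * s) (hb : X j * w = b * s) :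
    ∃ c, w = c * s := by
  have h1 : X j * a = X i * b := by
    refine mul_right_cancel₀ hs ?_
    rw [mul_assoc, ← ha, mul_assoc, ← hb]
    ring
  have h2 : X i ∣ X j * a := ⟨b, h1⟩
  rcases X_dvd_mul_iff.1 h2 with h | ⟨c, rfl⟩
  · exact absurd (X_dvd_X.1 h) hij
  · refine ⟨c, mul_left_cancel₀ (X_ne_zero i) ?_⟩
    rw [ha, mul_assoc]

end Homogeneous

namespace JetAlgebra

variable {n : ℕ} {A : Type*} [CommRing A] [Algebra ℝ A] (S : JetAlgebra n A)

/-- The value at a point of the symbol `∑ θ_K ξ^K`. -/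
def evPoly (ev : A →ₐ[ℝ] ℝ) (θ : (Fin n →₀ ℕ) →₀ A) : MvPolynomial (Fin n) ℝ :=
  AddMonoidAlgebra.ofCoeff (θ.mapRange ev (map_zero ev))

@[simp] theorem coeff_evPoly (ev : A →ₐ[ℝ] ℝ) (θ : (Fin n →₀ ℕ) →₀ A) (K : Fin n →₀ ℕ) :
    coeff K (evPoly ev θ) = ev (θ K) := rfl

/-- `evPoly` as an additive map. -/
def evPolyHom (ev : A →ₐ[ℝ] ℝ) : ((Fin n →₀ ℕ) →₀ A) →+ MvPolynomial (Fin n) ℝ where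
  toFun := evPoly ev
  map_zero' := by ext; simp
  map_add' θ η := by ext; simp

theorem evPoly_smul (ev : A →ₐ[ℝ] ℝ) (a : A) (θ : (Fin n →₀ ℕ) →₀ A) :
    evPoly ev (a • θ) = ev a • evPoly ev θ := by
  ext; simp

theorem coeff_evPoly_leftD (ev : A →ₐ[ℝ] ℝ) (i : Fin n) (θ : (Fin n →₀ ℕ) →₀ A)
    (K : Fin n →₀ ℕ) :
    coeff K (evPoly ev (S.leftD i θ)) = ev (S.D i (θ K)) + coeff K (X i * evPoly ev θ) := by
  by_cases hK : K i = 0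
  · rw [coeff_X_mul', if_neg (by simpa using hK), coeff_evPoly, leftD_apply_of_eq_zero _ _ _ _ hK,
      add_zero]
  · obtain ⟨J, rfl⟩ := eq_add_single hK
    rw [coeff_evPoly, leftD_apply_add_single, map_add, add_comm J, coeff_X_mul, coeff_evPoly]

theorem leftD_smul (i : Fin n) (a : A) (θ : (Fin n →₀ ℕ) →₀ A) :
    S.leftD i (a • θ) = S.D i a • θ + a • S.leftD i θ := by
  ext K
  by_cases hK : K i = 0
  · simp only [Finsupp.add_apply, Finsupp.smul_apply, leftD_apply_of_eq_zero _ _ _ _ hK,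
      smul_eq_mul, Derivation.leibniz]
    ring
  · obtain ⟨J, rfl⟩ := eq_add_single hK
    simp only [Finsupp.add_apply, Finsupp.smul_apply, leftD_apply_add_single,
      smul_eq_mul, Derivation.leibniz]
    ring

variable {S} {G : A} {N : ℕ}

theorem dU_DD_eq_zero (hord : ∀ J : Fin n →₀ ℕ, N < J.degree → S.dU J G = 0)
    (I K : Fin n →₀ ℕ) (hK : N + I.degree < K.degree) : S.dU K (S.DD I G) = 0 := by
  induction I using multiIndex_induction generalizing K with
  | zero =>
    rw [DD_zero]
    exact hord K (by simpa using hK)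
  | add_single I i ih =>
    rw [degree_add_single] at hK
    rw [DD_add_single]
    by_cases h : K i = 0
    · rw [dU_D_of_eq_zero _ _ _ _ h, ih K (by omega), map_zero]
    · obtain ⟨J, rfl⟩ := eq_add_single h
      rw [degree_add_single] at hK
      rw [dU_D_add_single, ih J (by omega), ih _ (by rw [degree_add_single]; omega), map_zero,
        add_zero]

variable (S G N) in
/-- The principal symbol of order `N` of `G` at a point. -/
def symbol (ev : A →ₐ[ℝ] ℝ) : MvPolynomial (Fin n) ℝ :=
  homogeneousComponent N (evPoly ev (S.vd G))

theorem symbol_isHomogeneous (ev : A →ₐ[ℝ] ℝ) : (symbol S G N ev).IsHomogeneous N :=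
  homogeneousComponent_isHomogeneous _ _

theorem coeff_symbol_of_degree_eq (ev : A →ₐ[ℝ] ℝ) {K : Fin n →₀ ℕ} (hK : K.degree = N) :
    coeff K (symbol S G N ev) = ev (S.dU K G) := by
  rw [symbol, coeff_homogeneousComponent, if_pos hK, coeff_evPoly, vd_apply]

/-- Composition with `D_i` multiplies the top-order part by `ξ_i`; its other effect, differentiating
coefficients, stays in lower order. Above degree `N + |I|` both sides vanish. -/
theorem coeff_evPoly_vd_DD (hord : ∀ J : Fin n →₀ ℕ, N < J.degree → S.dU J G = 0)
    (ev : A →ₐ[ℝ] ℝ) (I K : Fin n →₀ ℕ) (hK : N + I.degree ≤ K.degree) :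
    coeff K (evPoly ev (S.vd (S.DD I G))) = coeff K (monomial I 1 * symbol S G N ev) := by
  induction I using multiIndex_induction generalizing K with
  | zero =>
    rw [monomial_zero', C_1, one_mul, symbol, coeff_homogeneousComponent, DD_zero]
    split_ifs with h
    · rfl
    · rw [coeff_evPoly, vd_apply, hord K (by simp at hK; omega), map_zero]
  | add_single I i ih =>
    rw [degree_add_single] at hK
    have h1 : (monomial (I + single i 1) (1 : ℝ) : MvPolynomial (Fin n) ℝ)
        = X i * monomial I 1 := by
      rw [X, monomial_mul, add_comm, one_mul]
    rw [DD_add_single, vd_D, coeff_evPoly_leftD, vd_apply, dU_DD_eq_zero hord _ _ (by omega),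
      map_zero, map_zero, zero_add, h1, mul_assoc]
    by_cases h : K i = 0
    · rw [coeff_X_mul', coeff_X_mul', if_neg (by simpa using h), if_neg (by simpa using h)]
    · obtain ⟨J, rfl⟩ := eq_add_single h
      rw [degree_add_single] at hK
      rw [add_comm J, coeff_X_mul, coeff_X_mul, ih J (by omega)]

variable (S G) in
/-- The combinations `∑ c_I d(D_I G)` of the vertical differentials of the `D_I G` at a point. -/
def prolongation (ev : A →ₐ[ℝ] ℝ) : ((Fin n →₀ ℕ) →₀ ℝ) →ₗ[ℝ] MvPolynomial (Fin n) ℝ :=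
  Finsupp.linearCombination ℝ fun I => evPoly ev (S.vd (S.DD I G))

theorem coeff_prolongation (hord : ∀ J : Fin n →₀ ℕ, N < J.degree → S.dU J G = 0)
    (ev : A →ₐ[ℝ] ℝ) (c : (Fin n →₀ ℕ) →₀ ℝ) (d : ℕ)
    (hc : ∀ I : Fin n →₀ ℕ, d < I.degree → c I = 0) (K : Fin n →₀ ℕ) (hK : d + N ≤ K.degree) :
    coeff K (prolongation S G ev c)
      = coeff K ((AddMonoidAlgebra.ofCoeff c : MvPolynomial (Fin n) ℝ) * symbol S G N ev) := by
  have h1 : (AddMonoidAlgebra.ofCoeff c : MvPolynomial (Fin n) ℝ)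
      = ∑ I ∈ c.support, monomial I (c I) :=
    MvPolynomial.as_sum (AddMonoidAlgebra.ofCoeff c : MvPolynomial (Fin n) ℝ)
  rw [h1, Finset.sum_mul, coeff_sum, prolongation, linearCombination_apply, Finsupp.sum,
    coeff_sum]
  refine Finset.sum_congr rfl fun I hI => ?_
  have h2 : I.degree ≤ d := by
    by_contra h
    exact Finsupp.mem_support_iff.1 hI (hc I (by omega))
  rw [coeff_smul, coeff_evPoly_vd_DD hord ev I K (by omega), ← coeff_smul, ← smul_mul_assoc,
    smul_monomial, smul_eq_mul, mul_one]

/-- The top-degree part of `c` times the symbol is the top part of the combination, and polynomials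
have no zero divisors, so nothing cancels. For `m = 0` and `N ≥ 1` this is linear independence of
the `d(D_I G)`; in general it bounds the order of the multipliers. -/
theorem eq_zero_of_coeff_prolongation_eq_zero
    (hord : ∀ J : Fin n →₀ ℕ, N < J.degree → S.dU J G = 0) {ev : A →ₐ[ℝ] ℝ}
    (hs : symbol S G N ev ≠ 0) {c : (Fin n →₀ ℕ) →₀ ℝ} {m : ℕ}
    (hc : ∀ K : Fin n →₀ ℕ, m < K.degree → coeff K (prolongation S G ev c) = 0)
    (I : Fin n →₀ ℕ) (hI : m < I.degree + N) : c I = 0 := by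
  by_contra h
  obtain ⟨J, hJ, hmax⟩ := c.support.exists_max_image (fun J => J.degree)
    ⟨I, Finsupp.mem_support_iff.2 h⟩
  have hIJ : I.degree ≤ J.degree := hmax I (Finsupp.mem_support_iff.2 h)
  have hd (L : Fin n →₀ ℕ) (hL : J.degree < L.degree) : c L = 0 := by
    by_contra h'
    exact absurd (hmax L (Finsupp.mem_support_iff.2 h')) (by simpa using hL)
  set P : MvPolynomial (Fin n) ℝ := AddMonoidAlgebra.ofCoeff c with hP
  have h1 : homogeneousComponent J.degree P * symbol S G N ev = 0 := by
    rw [← homogeneousComponent_mul_of_isHomogeneous (symbol_isHomogeneous ev)]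
    ext K
    rw [coeff_homogeneousComponent, coeff_zero]
    split_ifs with hK
    · rw [← coeff_prolongation hord ev c J.degree hd K (by omega)]
      exact hc K (by omega)
    · rfl
  have h2 := congrArg (coeff J) ((mul_eq_zero.1 h1).resolve_right hs)
  rw [coeff_homogeneousComponent, if_pos rfl, coeff_zero] at h2
  exact Finsupp.mem_support_iff.1 hJ h2

instance instFiniteDegreeEq (n j : ℕ) : Finite {K : Fin n →₀ ℕ // K.degree = j} := by
  refine Set.Finite.to_subtype (s := {K : Fin n →₀ ℕ | K.degree = j}) ?_
  refine (Set.finite_Iic (equivFunOnFinite.symm fun _ : Fin n => j)).subset ?_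
  intro K hK i
  exact (le_degree i K).trans_eq hK

instance instFintypeDegreeEq (n j : ℕ) : Fintype {K : Fin n →₀ ℕ // K.degree = j} :=
  Fintype.ofFinite _

variable (S G) in
/-- Multiplication by the symbol of `G`, from degree `r` to degree `j`. -/
def symbolMatrix (r j : ℕ) :
    Matrix {K : Fin n →₀ ℕ // K.degree = j} {I : Fin n →₀ ℕ // I.degree = r} A :=
  Matrix.of fun K I => if I.1 ≤ K.1 then S.dU (K.1 - I.1) G else 0

theorem symbolMatrix_map_mulVec (ev : A →ₐ[ℝ] ℝ) {r j : ℕ} (hj : j = r + N)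
    (a : {I : Fin n →₀ ℕ // I.degree = r} → ℝ) (K : {K : Fin n →₀ ℕ // K.degree = j}) :
    (((symbolMatrix S G r j).map ev).mulVec a) K
      = coeff K.1 ((∑ I, monomial I.1 (a I)) * symbol S G N ev) := by
  rw [Finset.sum_mul, coeff_sum]
  refine Finset.sum_congr rfl fun I _ => ?_
  change ev (if I.1 ≤ K.1 then S.dU (K.1 - I.1) G else 0) * a I = _
  rw [coeff_monomial_mul']
  split_ifs with h
  · rw [coeff_symbol_of_degree_eq, mul_comm]
    have h1 := congrArg degree (tsub_add_cancel_of_le h)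
    rw [map_add, K.2, I.2] at h1
    omega
  · simp

theorem coeff_sum_monomial_subtype {r : ℕ} (a : {I : Fin n →₀ ℕ // I.degree = r} → ℝ)
    (J : {I : Fin n →₀ ℕ // I.degree = r}) :
    coeff J.1 (∑ I, monomial I.1 (a I) : MvPolynomial (Fin n) ℝ) = a J := by
  classical
  simp only [coeff_sum, coeff_monomial, Subtype.coe_inj]
  simp

theorem sum_monomial_subtype_isHomogeneous {r : ℕ}
    (a : {I : Fin n →₀ ℕ // I.degree = r} → ℝ) :
    (∑ I, monomial I.1 (a I) : MvPolynomial (Fin n) ℝ).IsHomogeneous r :=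
  IsHomogeneous.sum _ _ _ fun I _ => isHomogeneous_monomial _ I.2

theorem symbolMatrix_map_mulVec_injective {ev : A →ₐ[ℝ] ℝ} {r j : ℕ} (hj : j = r + N)
    (hs : symbol S G N ev ≠ 0) {a : {I : Fin n →₀ ℕ // I.degree = r} → ℝ}
    (ha : ((symbolMatrix S G r j).map ev).mulVec a = 0) : a = 0 := by
  have h1 : (∑ I, monomial I.1 (a I)) * symbol S G N ev = 0 := by
    ext K
    rw [coeff_zero]
    by_cases hK : K.degree = j
    · rw [← symbolMatrix_map_mulVec ev hj a ⟨K, hK⟩, ha]; rfl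
    · refine ((sum_monomial_subtype_isHomogeneous a).mul
        (symbol_isHomogeneous ev)).coeff_eq_zero ?_
      omega
  funext J
  rw [← coeff_sum_monomial_subtype a J, (mul_eq_zero.1 h1).resolve_right hs]
  rfl

/-- Division by the symbol with quotient coefficients in `A`, not merely pointwise, because they
will be differentiated. The normal equations give it: multiplication by a nonzero symbol is
injective at each point, so the Gram determinant vanishes nowhere and is a unit. Where a pointwise
quotient `b` exists, `a` evaluates to it. -/
theorem exists_symbolMatrix_mulVec {Pt : Type*} (ev : Pt → A →ₐ[ℝ] ℝ)
    (hunit : ∀ a : A, (∀ q, ev q a ≠ 0) → IsUnit a) (hs : ∀ q, symbol S G N (ev q) ≠ 0)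
    {r j : ℕ} (hj : j = r + N) (y : {K : Fin n →₀ ℕ // K.degree = j} → A) :
    ∃ a : {I : Fin n →₀ ℕ // I.degree = r} → A, ∀ q b,
      ((symbolMatrix S G r j).map (ev q)).mulVec b = (fun K => ev q (y K)) →
        ∀ I, ev q (a I) = b I := by
  classical
  set M := symbolMatrix S G r j with hM
  have hmap (q : Pt) : (M.transpose * M).map (ev q)
      = (M.map (ev q)).transpose * M.map (ev q) := by
    rw [Matrix.map_mul, Matrix.transpose_map]
  have hinj (q : Pt) (v) (hv : ((M.transpose * M).map (ev q)).mulVec v = 0) : v = 0 := by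
    rw [hmap] at hv
    have h1 : v ∈ LinearMap.ker ((M.map (ev q)).transpose * M.map (ev q)).mulVecLin := hv
    rw [Matrix.ker_mulVecLin_transpose_mul_self] at h1
    exact symbolMatrix_map_mulVec_injective hj (hs q) h1
  have hdet : IsUnit (M.transpose * M).det := by
    refine hunit _ fun q hq => ?_
    have h1 : ((M.transpose * M).map (ev q)).det = 0 := by
      rw [← hq]
      exact (RingHom.map_det (ev q).toRingHom (M.transpose * M)).symm
    obtain ⟨v, hv, hv'⟩ := Matrix.exists_mulVec_eq_zero_iff.2 h1
    exact hv (hinj q v hv')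
  refine ⟨(M.transpose * M)⁻¹.mulVec (M.transpose.mulVec y), fun q b hb => ?_⟩
  set a := (M.transpose * M)⁻¹.mulVec (M.transpose.mulVec y) with ha
  have h1 : (M.transpose * M).mulVec a = M.transpose.mulVec y := by
    rw [ha, Matrix.mulVec_mulVec, Matrix.mul_nonsing_inv _ hdet, Matrix.one_mulVec]
  have h2 : ((M.transpose * M).map (ev q)).mulVec (fun I => ev q (a I))
      = ((M.map (ev q)).transpose).mulVec (fun K => ev q (y K)) := by
    funext I
    have h3 := congrArg (ev q) (congrFun h1 I)
    have h4 := RingHom.map_mulVec (ev q).toRingHom (M.transpose * M) a I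
    have h5 := RingHom.map_mulVec (ev q).toRingHom M.transpose y I
    exact h4.symm.trans (h3.trans h5)
  have h6 : ((M.transpose * M).map (ev q)).mulVec ((fun I => ev q (a I)) - b) = 0 := by
    rw [Matrix.mulVec_sub, h2, hmap, ← Matrix.mulVec_mulVec, hb, sub_self]
  intro I
  have := congrFun (hinj q _ h6) I
  simpa [sub_eq_zero] using this

/-- Downward induction on the order `j` of `θ` along `E`. The degree `j` part is divisible by the
symbol, and subtracting `∑ a_I d(D_I G)` removes it while preserving the hypothesis on `D_i ∘ θ`.
The differentiation of coefficients in `D_i ∘ θ` is harmless at top order, because by `htan` the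
total derivatives of a function vanishing on `E` vanish there too. -/
theorem evPoly_mem_range_prolongation (hn : 2 ≤ n)
    (hord : ∀ J : Fin n →₀ ℕ, N < J.degree → S.dU J G = 0)
    {Pt : Type*} (ev : Pt → A →ₐ[ℝ] ℝ) (E : Set Pt)
    (hunit : ∀ a : A, (∀ q, ev q a ≠ 0) → IsUnit a) (hs : ∀ q, symbol S G N (ev q) ≠ 0)
    (htan : ∀ f : A, (∀ q ∈ E, ev q f = 0) → ∀ q ∈ E, ∀ i, ev q (S.D i f) = 0) (j : ℕ)
    (θ : (Fin n →₀ ℕ) →₀ A)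
    (hj : ∀ q ∈ E, ∀ K : Fin n →₀ ℕ, j ≤ K.degree → ev q (θ K) = 0)
    (hθ : ∀ i, ∀ q ∈ E, evPoly (ev q) (S.leftD i θ) ∈ LinearMap.range (prolongation S G (ev q)))
    (q : Pt) (hq : q ∈ E) : evPoly (ev q) θ ∈ LinearMap.range (prolongation S G (ev q)) := by
  induction j generalizing θ q with
  | zero =>
    have : evPoly (ev q) θ = 0 := by
      ext K
      exact hj q hq K (Nat.zero_le _)
    rw [this]
    exact Submodule.zero_mem _
  | succ j ih =>
    have hdiv (q : Pt) (hq : q ∈ E) : ∃ b,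
        homogeneousComponent j (evPoly (ev q) θ) = b * symbol S G N (ev q) := by
      have hX (i : Fin n) : ∃ b, X i * homogeneousComponent j (evPoly (ev q) θ)
          = b * symbol S G N (ev q) := by
        obtain ⟨c, hc⟩ := hθ i q hq
        have hcoef (K : Fin n →₀ ℕ) (hK : j + 1 ≤ K.degree) :
            coeff K (prolongation S G (ev q) c) = coeff K (X i * evPoly (ev q) θ) := by
          rw [hc, coeff_evPoly_leftD, htan (θ K) (fun q hq => hj q hq K hK) q hq, zero_add]
        have hzero (K : Fin n →₀ ℕ) (hK : j + 1 < K.degree) :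
            coeff K (prolongation S G (ev q) c) = 0 := by
          rw [hcoef K hK.le]
          by_cases h : K i = 0
          · rw [coeff_X_mul', if_neg (by simpa using h)]
          · obtain ⟨J, rfl⟩ := eq_add_single h
            rw [degree_add_single] at hK
            rw [add_comm J, coeff_X_mul, coeff_evPoly]
            exact hj q hq J (by omega)
        have hc0 := eq_zero_of_coeff_prolongation_eq_zero hord (hs q) hzero
        have hXi : X i * homogeneousComponent j (evPoly (ev q) θ)
            = homogeneousComponent (j + 1) (X i * evPoly (ev q) θ) := by
          rw [mul_comm, mul_comm (X i),
            homogeneousComponent_mul_of_isHomogeneous (isHomogeneous_X ℝ i)]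
        rcases le_or_gt N (j + 1) with h | h
        · refine ⟨homogeneousComponent (j + 1 - N) (AddMonoidAlgebra.ofCoeff c), ?_⟩
          rw [hXi, ← homogeneousComponent_mul_of_isHomogeneous (symbol_isHomogeneous _)]
          ext K
          rw [coeff_homogeneousComponent, coeff_homogeneousComponent, Nat.sub_add_cancel h]
          split_ifs with hK
          · rw [← hcoef K hK.ge, coeff_prolongation hord _ c (j + 1 - N)
              (fun I hI => hc0 I (by omega)) K (by omega)]
          · rfl
        · refine ⟨0, ?_⟩
          -- The order `j + 1` is below `N`, the least possible order of a nonzero combination.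
          have : c = 0 := by
            ext I
            exact hc0 I (by omega)
          rw [hXi, zero_mul]
          ext K
          rw [coeff_homogeneousComponent, coeff_zero]
          split_ifs with hK
          · rw [← hcoef K hK.ge, this, map_zero, coeff_zero]
          · rfl
      obtain ⟨a, ha⟩ := hX ⟨0, by omega⟩
      obtain ⟨b, hb⟩ := hX ⟨1, by omega⟩
      exact exists_eq_mul_of_X_mul_eq_mul (by simp) (hs q) ha hb
    -- For `j < N` a form of degree `j` divisible by the symbol is zero, so no correction is needed.
    rcases lt_or_ge j N with hjN | hjN
    · refine ih θ (fun q hq K hK => ?_) hθ q hq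
      rcases hK.eq_or_lt with h | h
      · obtain ⟨b, hb⟩ := hdiv q hq
        have h1 := congrArg (fun p => coeff K (homogeneousComponent j p)) hb
        simp only [homogeneousComponent_mul_of_lt (symbol_isHomogeneous (ev q)) b hjN] at h1
        simpa [coeff_homogeneousComponent, h.symm] using h1
      · exact hj q hq K h
    · obtain ⟨r, rfl⟩ := Nat.exists_eq_add_of_le' hjN
      obtain ⟨a, ha⟩ := exists_symbolMatrix_mulVec ev hunit hs (r := r) (j := r + N) rfl
        (fun K => θ K.1)
      have hdiv' (q : Pt) (hq : q ∈ E) (K : Fin n →₀ ℕ) (hK : K.degree = r + N) :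
          ev q (θ K) = coeff K ((∑ I, monomial I.1 (ev q (a I))) * symbol S G N (ev q)) := by
        obtain ⟨b, hb⟩ := hdiv q hq
        have h1 : homogeneousComponent (r + N) (evPoly (ev q) θ)
            = (∑ I : {I : Fin n →₀ ℕ // I.degree = r}, monomial I.1 (coeff I.1 b))
              * symbol S G N (ev q) := by
          have h2 : (∑ I : {I : Fin n →₀ ℕ // I.degree = r}, monomial I.1 (coeff I.1 b))
              = homogeneousComponent r b := by
            ext J
            rw [coeff_homogeneousComponent]
            split_ifs with hJ
            · exact coeff_sum_monomial_subtype (fun I => coeff I.1 b) ⟨J, hJ⟩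
            · exact (sum_monomial_subtype_isHomogeneous _).coeff_eq_zero hJ
          rw [h2, ← homogeneousComponent_mul_of_isHomogeneous (symbol_isHomogeneous _), ← hb,
            homogeneousComponent_eq_self (homogeneousComponent_isHomogeneous _ _)]
        have h3 (K : Fin n →₀ ℕ) (hK : K.degree = r + N) : ev q (θ K)
            = coeff K ((∑ I : {I : Fin n →₀ ℕ // I.degree = r}, monomial I.1 (coeff I.1 b))
              * symbol S G N (ev q)) := by
          rw [← h1, coeff_homogeneousComponent, if_pos hK, coeff_evPoly]
        have h4 := ha q (fun I => coeff I.1 b) (by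
          funext K
          rw [symbolMatrix_map_mulVec (ev q) rfl, ← h3 K.1 K.2])
        simp only [h4]
        exact h3 K hK
      have hmem (q : Pt) (I : Fin n →₀ ℕ) : evPoly (ev q) (S.vd (S.DD I G))
          ∈ LinearMap.range (prolongation S G (ev q)) :=
        ⟨single I 1, by rw [prolongation, linearCombination_single, one_smul]⟩
      have key := ih (θ - ∑ I, a I • S.vd (S.DD I.1 G)) ?_ ?_ q hq
      · have h1 : evPoly (ev q) θ = evPoly (ev q) (θ - ∑ I, a I • S.vd (S.DD I.1 G))
            + ∑ I, ev q (a I) • evPoly (ev q) (S.vd (S.DD I.1 G)) := by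
          simp only [← evPoly_smul]
          change evPolyHom (ev q) θ = evPolyHom (ev q) _ + ∑ I, evPolyHom (ev q) _
          rw [← map_sum, ← map_add, sub_add_cancel]
        rw [h1]
        exact Submodule.add_mem _ key
          (Submodule.sum_mem _ fun I _ => Submodule.smul_mem _ _ (hmem q _))
      · intro q hq K hK
        rw [Finsupp.sub_apply, Finsupp.finsetSum_apply, map_sub, map_sum, sub_eq_zero]
        simp only [Finsupp.smul_apply, smul_eq_mul, map_mul, vd_apply]
        rcases hK.eq_or_lt with h | h
        · rw [hdiv' q hq K h.symm, Finset.sum_mul, coeff_sum]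
          refine Finset.sum_congr rfl fun I _ => ?_
          have h2 := coeff_evPoly_vd_DD hord (ev q) I.1 K (by rw [I.2]; omega)
          rw [coeff_evPoly, vd_apply] at h2
          have h3 : (monomial I.1 (ev q (a I)) : MvPolynomial (Fin n) ℝ)
              = ev q (a I) • monomial I.1 1 := by
            rw [smul_monomial, smul_eq_mul, mul_one]
          rw [h2, h3, smul_mul_assoc, coeff_smul, smul_eq_mul]
        · rw [hj q hq K h, Finset.sum_eq_zero]
          intro I _
          rw [dU_DD_eq_zero hord _ _ (by rw [I.2]; omega), map_zero, mul_zero]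
      -- The correction changes `D_i ∘ θ` by multiples of `d(D_I G)` and `d(D_{I,i} G)`, which lie
      -- in the range.
      · intro i q hq
        have h1 : evPoly (ev q) (S.leftD i (θ - ∑ I, a I • S.vd (S.DD I.1 G)))
            = evPoly (ev q) (S.leftD i θ) - ∑ I, (ev q (S.D i (a I)) •
              evPoly (ev q) (S.vd (S.DD I.1 G))
              + ev q (a I) • evPoly (ev q) (S.vd (S.DD (I.1 + single i 1) G))) := by
          rw [map_sub, map_sum]
          simp only [leftD_smul, ← vd_D, ← DD_add_single, ← evPoly_smul]
          change evPolyHom (ev q) _ = evPolyHom (ev q) _ - ∑ I, (evPolyHom (ev q) _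
            + evPolyHom (ev q) _)
          simp only [map_sub, map_sum, map_add]
        rw [h1]
        exact Submodule.sub_mem _ (hθ i q hq) (Submodule.sum_mem _ fun I _ => Submodule.add_mem _
          (Submodule.smul_mem _ _ (hmem q _)) (Submodule.smul_mem _ _ (hmem q _)))

end JetAlgebra

end JetCalculus

/-! ### The algebra of differential functions on an open set of jets. -/

namespace JetCalculus

open Finsupp

variable {n : ℕ}

/-- Truncation of jets as a continuous linear map. -/
def truncateL (n k : ℕ) : Jet n →L[ℝ] FiniteJet n k :=
  (ContinuousLinearMap.fst ℝ _ _).prod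
    ((ContinuousLinearMap.pi fun J : MultiIndexLE n k => ContinuousLinearMap.proj J.1).comp
      (ContinuousLinearMap.snd ℝ _ _))

/-- The projection from jets of order `l` to jets of order `k`. -/
def restrictL (n : ℕ) {k l : ℕ} (h : k ≤ l) : FiniteJet n l →L[ℝ] FiniteJet n k :=
  (ContinuousLinearMap.fst ℝ _ _).prod
    ((ContinuousLinearMap.pi fun J : MultiIndexLE n k =>
      ContinuousLinearMap.proj (⟨J.1, J.2.trans h⟩ : MultiIndexLE n l)).comp
      (ContinuousLinearMap.snd ℝ _ _))

theorem restrictL_truncate {k l : ℕ} (h : k ≤ l) (p : Jet n) :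
    restrictL n h (truncate l p) = truncate k p := rfl

/-- The jet with the coordinates of `z` up to order `k`, and those of `p` above. -/
def splice (k : ℕ) (p : Jet n) (z : FiniteJet n k) : Jet n :=
  (z.1, fun J => if h : deg J ≤ k then z.2 ⟨J, h⟩ else p.2 J)

theorem truncate_splice (k : ℕ) (p : Jet n) (z : FiniteJet n k) :
    truncate k (splice k p z) = z := by
  ext J
  · rfl
  · simp [truncate, splice, J.2]

theorem splice_truncate (k : ℕ) (p : Jet n) : splice k p (truncate k p) = p := by
  ext J
  · rfl
  · simp [truncate, splice]

theorem continuous_splice (k : ℕ) (p : Jet n) : Continuous (splice k p) := by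
  refine continuous_fst.prodMk (continuous_pi fun J => ?_)
  by_cases h : deg J ≤ k
  · simp only [h, dif_pos]
    fun_prop
  · simp only [h, dif_neg, not_false_eq_true]
    fun_prop

/-- Through each `p`, `splice k p` is a continuous section of the truncation. -/
theorem isOpen_truncate_image {V : Set (Jet n)} (hV : IsOpen V) (k : ℕ) :
    IsOpen (truncate k '' V) := by
  rw [isOpen_iff_mem_nhds]
  rintro _ ⟨p, hp, rfl⟩
  have h1 : splice k p ⁻¹' V ∈ 𝓝 (truncate k p) :=
    (continuous_splice k p).continuousAt.preimage_mem_nhds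
      (hV.mem_nhds (by rwa [splice_truncate]))
  filter_upwards [h1] with z hz
  exact ⟨_, hz, truncate_splice k p z⟩

/-- `F` is a smooth function of jets of order `k` representing the function `f` on `V`. -/
def Represents {V : Set (Jet n)} (k : ℕ) (F : FiniteJet n k → ℝ) (f : V → ℝ) : Prop :=
  ContDiffOn ℝ ∞ F (truncate k '' V) ∧ ∀ p : V, f p = F (truncate k p)

theorem Represents.mono {V : Set (Jet n)} {k l : ℕ} {F : FiniteJet n k → ℝ} {f : V → ℝ}
    (hF : Represents k F f) (h : k ≤ l) : Represents l (F ∘ restrictL n h) f := by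
  refine ⟨hF.1.comp (restrictL n h).contDiff.contDiffOn ?_, fun p => hF.2 p⟩
  rintro _ ⟨p, hp, rfl⟩
  exact ⟨p, hp, rfl⟩

/-- The algebra of differential functions on `V`. -/
def DiffAlg (V : Set (Jet n)) : Subalgebra ℝ (V → ℝ) where
  carrier := {f | ∃ k F, Represents k F f}
  mul_mem' := by
    rintro f g ⟨k, F, hF⟩ ⟨l, H, hH⟩
    have hF' := hF.mono (le_max_left k l)
    have hH' := hH.mono (le_max_right k l)
    exact ⟨_, _, hF'.1.mul hH'.1, fun p => congrArg₂ (· * ·) (hF'.2 p) (hH'.2 p)⟩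
  add_mem' := by
    rintro f g ⟨k, F, hF⟩ ⟨l, H, hH⟩
    have hF' := hF.mono (le_max_left k l)
    have hH' := hH.mono (le_max_right k l)
    exact ⟨_, _, hF'.1.add hH'.1, fun p => congrArg₂ (· + ·) (hF'.2 p) (hH'.2 p)⟩
  algebraMap_mem' r := ⟨0, fun _ => r, contDiffOn_const, fun _ => rfl⟩

/-- Evaluation at a point. -/
def evalAt {V : Set (Jet n)} (q : V) : DiffAlg V →ₐ[ℝ] ℝ :=
  (Pi.evalAlgHom ℝ (fun _ : V => ℝ) q).comp (DiffAlg V).val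

theorem evalAt_apply {V : Set (Jet n)} (q : V) (f : DiffAlg V) : evalAt q f = f.1 q := rfl

theorem ext_evalAt {V : Set (Jet n)} {f g : DiffAlg V} (h : ∀ q, evalAt q f = evalAt q g) :
    f = g :=
  Subtype.ext (funext h)

theorem isUnit_of_evalAt_ne_zero {V : Set (Jet n)} {f : DiffAlg V} (h : ∀ q, evalAt q f ≠ 0) :
    IsUnit f := by
  obtain ⟨k, F, hF⟩ := f.2
  have h1 : Represents k F⁻¹ (f.1)⁻¹ := by
    refine ⟨hF.1.inv ?_, fun p => congrArg _ (hF.2 p)⟩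
    rintro _ ⟨p, hp, rfl⟩
    rw [← hF.2 ⟨p, hp⟩]
    exact h _
  refine IsUnit.of_mul_eq_one ⟨(f.1)⁻¹, k, _, h1⟩ (ext_evalAt fun q => ?_)
  exact mul_inv_cancel₀ (h q)

/-- Extension by zero of a function on `V`. -/
def extendZero {V : Set (Jet n)} (f : V → ℝ) : Jet n → ℝ :=
  Function.extend Subtype.val f 0

theorem extendZero_apply {V : Set (Jet n)} (f : V → ℝ) (p : V) : extendZero f p = f p :=
  Subtype.val_injective.extend_apply f 0 p

/-- Near `q` a line in jet space stays in `V`, where `g` is `F` along the truncated line. Values of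
`g` outside `V` are therefore irrelevant. -/
theorem Represents.hasLineDerivAt {V : Set (Jet n)} (hV : IsOpen V) {k : ℕ}
    {F : FiniteJet n k → ℝ} {f : V → ℝ} (hF : Represents k F f) {g : Jet n → ℝ}
    (hg : ∀ p : V, g p = f p) (q : V) (v : Jet n) :
    HasLineDerivAt ℝ g (fderiv ℝ F (truncate k q) (truncate k v)) q v := by
  have h1 : HasFDerivAt F (fderiv ℝ F (truncate k q)) (truncate k q) :=
    ((hF.1.contDiffAt ((isOpen_truncate_image hV k).mem_nhds ⟨q, q.2, rfl⟩)).differentiableAt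
      (by simp)).hasFDerivAt
  have h2 := h1.hasLineDerivAt (truncate k v)
  have h3 : (fun t : ℝ => g (q + t • v)) =ᶠ[𝓝 0]
      fun t : ℝ => F (truncate k q + t • truncate k v) := by
    have h4 : Continuous fun t : ℝ => (q : Jet n) + t • v := by fun_prop
    have h5 := h4.continuousAt.preimage_mem_nhds (x := 0) (hV.mem_nhds (by simp))
    filter_upwards [h5] with t ht
    rw [hg ⟨_, ht⟩, hF.2 ⟨_, ht⟩]
    rfl
  exact HasDerivAt.congr_of_eventuallyEq h2 h3

theorem Represents.lineDeriv_extendZero {V : Set (Jet n)} (hV : IsOpen V) {k : ℕ}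
    {F : FiniteJet n k → ℝ} {f : V → ℝ} (hF : Represents k F f) (q : V) (v : Jet n) :
    lineDeriv ℝ (extendZero f) q v = fderiv ℝ F (truncate k q) (truncate k v) :=
  (hF.hasLineDerivAt hV (extendZero_apply f) q v).lineDeriv

theorem Represents.lineDeriv {V : Set (Jet n)} (hV : IsOpen V) {k : ℕ}
    {F : FiniteJet n k → ℝ} {f : V → ℝ} (hF : Represents k F f) (v : Jet n) :
    Represents k (fun z => fderiv ℝ F z (truncate k v))
      (fun q : V => lineDeriv ℝ (extendZero f) q v) :=
  ⟨(hF.1.fderiv_of_isOpen (isOpen_truncate_image hV k) (by simp)).clm_apply contDiffOn_const,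
    fun q => hF.lineDeriv_extendZero hV q v⟩

theorem Represents.differentiableAt {V : Set (Jet n)} (hV : IsOpen V) {k : ℕ}
    {F : FiniteJet n k → ℝ} {f : V → ℝ} (hF : Represents k F f) (q : V) :
    DifferentiableAt ℝ F (truncate k q) :=
  (hF.1.contDiffAt ((isOpen_truncate_image hV k).mem_nhds ⟨q, q.2, rfl⟩)).differentiableAt
    (by simp)

/-- The derivation of the algebra of differential functions along a constant vector. -/
def dirDeriv {V : Set (Jet n)} (hV : IsOpen V) (v : Jet n) :
    Derivation ℝ (DiffAlg V) (DiffAlg V) :=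
  Derivation.mk'
    { toFun := fun f => ⟨fun q => lineDeriv ℝ (extendZero f.1) q v, by
        obtain ⟨k, F, hF⟩ := f.2
        exact ⟨k, _, hF.lineDeriv hV v⟩⟩
      map_add' := fun f g => by
        obtain ⟨k, F, hF⟩ := f.2
        obtain ⟨l, H, hH⟩ := g.2
        have hF' := hF.mono (le_max_left k l)
        have hH' := hH.mono (le_max_right k l)
        have hs : Represents _ (_ + _) (f + g).1 :=
          ⟨hF'.1.add hH'.1, fun p => congrArg₂ (· + ·) (hF'.2 p) (hH'.2 p)⟩
        refine Subtype.ext (funext fun q => ?_)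
        change _root_.lineDeriv ℝ (extendZero (f + g).1) (q : Jet n) v = _root_.lineDeriv ℝ _ (q : Jet n) v
          + _root_.lineDeriv ℝ _ (q : Jet n) v
        rw [hs.lineDeriv_extendZero hV, hF'.lineDeriv_extendZero hV, hH'.lineDeriv_extendZero hV,
          fderiv_add (hF'.differentiableAt hV q) (hH'.differentiableAt hV q)]
        rfl
      map_smul' := fun r f => by
        obtain ⟨k, F, hF⟩ := f.2
        have hs : Represents k (r • F) (r • f).1 :=
          ⟨hF.1.const_smul r, fun p => congrArg (r • ·) (hF.2 p)⟩
        refine Subtype.ext (funext fun q => ?_)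
        change _root_.lineDeriv ℝ (extendZero (r • f).1) (q : Jet n) v = r • _root_.lineDeriv ℝ _ (q : Jet n) v
        rw [hs.lineDeriv_extendZero hV, hF.lineDeriv_extendZero hV,
          fderiv_const_smul (hF.differentiableAt hV q)]
        rfl }
    (fun f g => by
        obtain ⟨k, F, hF⟩ := f.2
        obtain ⟨l, H, hH⟩ := g.2
        have hF' := hF.mono (le_max_left k l)
        have hH' := hH.mono (le_max_right k l)
        have hs : Represents _ (_ * _) (f * g).1 :=
          ⟨hF'.1.mul hH'.1, fun p => congrArg₂ (· * ·) (hF'.2 p) (hH'.2 p)⟩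
        refine Subtype.ext (funext fun q => ?_)
        change _root_.lineDeriv ℝ (extendZero (f * g).1) (q : Jet n) v = f.1 q * _root_.lineDeriv ℝ _ (q : Jet n) v
          + g.1 q * _root_.lineDeriv ℝ _ (q : Jet n) v
        rw [hs.lineDeriv_extendZero hV, hF'.lineDeriv_extendZero hV, hH'.lineDeriv_extendZero hV,
          fderiv_mul (hF'.differentiableAt hV q) (hH'.differentiableAt hV q), hF'.2 q, hH'.2 q]
        rfl)

theorem evalAt_dirDeriv {V : Set (Jet n)} (hV : IsOpen V) (v : Jet n) {f : DiffAlg V} {k : ℕ}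
    {F : FiniteJet n k → ℝ} (hF : Represents k F f.1) (q : V) :
    evalAt q (dirDeriv hV v f) = fderiv ℝ F (truncate k q) (truncate k v) :=
  hF.lineDeriv_extendZero hV q v

theorem represents_dirDeriv {V : Set (Jet n)} (hV : IsOpen V) (v : Jet n) {f : DiffAlg V} {k : ℕ}
    {F : FiniteJet n k → ℝ} (hF : Represents k F f.1) :
    Represents k (fun z => fderiv ℝ F z (truncate k v)) (dirDeriv hV v f).1 :=
  hF.lineDeriv hV v

theorem dirDeriv_comm {V : Set (Jet n)} (hV : IsOpen V) (v w : Jet n) (f : DiffAlg V) :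
    dirDeriv hV v (dirDeriv hV w f) = dirDeriv hV w (dirDeriv hV v f) := by
  obtain ⟨k, F, hF⟩ := f.2
  refine ext_evalAt fun q => ?_
  rw [evalAt_dirDeriv hV v (represents_dirDeriv hV w hF),
    evalAt_dirDeriv hV w (represents_dirDeriv hV v hF)]
  have h1 : ContDiffAt ℝ ∞ F (truncate k q) :=
    hF.1.contDiffAt ((isOpen_truncate_image hV k).mem_nhds ⟨q, q.2, rfl⟩)
  have h2 : DifferentiableAt ℝ (fderiv ℝ F) (truncate k q) :=
    (h1.fderiv_right (m := 1) (WithTop.coe_le_coe.2 le_top : ((1 + 1 : ℕ∞) : WithTop ℕ∞) ≤ ∞)).differentiableAt (by simp)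
  have h3 (a b : FiniteJet n k) : fderiv ℝ (fun z => fderiv ℝ F z a) (truncate k q) b
      = fderiv ℝ (fderiv ℝ F) (truncate k q) b a := by
    rw [fderiv_clm_apply h2 (differentiableAt_const a)]
    simp
  rw [h3, h3]
  exact (h1.isSymmSndFDerivAt (by
    rw [minSmoothness_of_isRCLikeNormedField]
    exact (WithTop.coe_le_coe.2 le_top : ((2 : ℕ∞) : WithTop ℕ∞) ≤ ∞))) _ _

theorem deg_coe (K : Fin n →₀ ℕ) : deg (K : Fin n → ℕ) = K.degree := by
  rw [deg, degree_eq_sum]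

/-- The base coordinates as differential functions. -/
def coordX (V : Set (Jet n)) (j : Fin n) : DiffAlg V :=
  ⟨fun q => q.1.1 j, 0, fun z => z.1 j, by fun_prop, fun _ => rfl⟩

/-- The fibre coordinates as differential functions. -/
def coordU (V : Set (Jet n)) (K : Fin n →₀ ℕ) : DiffAlg V :=
  ⟨fun q => q.1.2 K, deg K, fun z => z.2 ⟨K, le_rfl⟩, by fun_prop, fun _ => rfl⟩

theorem evalAt_dirDeriv_coordX {V : Set (Jet n)} (hV : IsOpen V) (v : Jet n) (j : Fin n) (q : V) :
    evalAt q (dirDeriv hV v (coordX V j)) = v.1 j := by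
  have h1 : Represents 0 ((ContinuousLinearMap.proj j).comp
      (ContinuousLinearMap.fst ℝ (Fin n → ℝ) (MultiIndexLE n 0 → ℝ))) (coordX V j).1 :=
    ⟨ContinuousLinearMap.contDiff _ |>.contDiffOn, fun _ => rfl⟩
  rw [evalAt_dirDeriv hV v h1, ContinuousLinearMap.fderiv]
  rfl

theorem evalAt_dirDeriv_coordU {V : Set (Jet n)} (hV : IsOpen V) (v : Jet n) (K : Fin n →₀ ℕ)
    (q : V) : evalAt q (dirDeriv hV v (coordU V K)) = v.2 K := by
  have h1 : Represents (deg K) ((ContinuousLinearMap.proj ⟨K, le_rfl⟩).comp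
      (ContinuousLinearMap.snd ℝ (Fin n → ℝ) (MultiIndexLE n (deg K) → ℝ))) (coordU V K).1 :=
    ⟨ContinuousLinearMap.contDiff _ |>.contDiffOn, fun _ => rfl⟩
  rw [evalAt_dirDeriv hV v h1, ContinuousLinearMap.fderiv]
  rfl

theorem dirDeriv_eq_zero {V : Set (Jet n)} (hV : IsOpen V) {f : DiffAlg V} {k : ℕ}
    {F : FiniteJet n k → ℝ} (hF : Represents k F f.1) {v : Jet n} (hv : truncate k v = 0) :
    dirDeriv hV v f = 0 :=
  ext_evalAt fun q => by rw [evalAt_dirDeriv hV v hF, hv, map_zero, map_zero]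

theorem truncate_single_eq_zero {k : ℕ} {K : Fin n →₀ ℕ} (h : k < K.degree) :
    truncate k ((0, Pi.single K 1) : Jet n) = 0 := by
  ext J
  · rfl
  · have : J.1 ≠ K := by
      intro h1
      have := J.2
      rw [h1, deg_coe] at this
      omega
    exact Pi.single_eq_of_ne this _

/-- The jet space structure of the algebra of differential functions on an open set. -/
def jetAlgebra {V : Set (Jet n)} (hV : IsOpen V) : JetAlgebra n (DiffAlg V) where
  dX i := dirDeriv hV (Pi.single i 1, 0)
  dU K := dirDeriv hV (0, Pi.single K 1)
  x := coordX V
  u := coordU V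
  dX_dX _ _ _ := dirDeriv_comm hV _ _ _
  dX_dU _ _ _ := dirDeriv_comm hV _ _ _
  dU_dU _ _ _ := dirDeriv_comm hV _ _ _
  dX_x i j := ext_evalAt fun q => by
    rw [evalAt_dirDeriv_coordX]
    by_cases h : i = j
    · rw [if_pos h, h, map_one]
      exact Pi.single_eq_same _ _
    · rw [if_neg h, map_zero]
      exact Pi.single_eq_of_ne' h _
  dU_x K j := ext_evalAt fun q => by
    rw [evalAt_dirDeriv_coordX, map_zero]
    rfl
  dX_u i K := ext_evalAt fun q => by
    rw [evalAt_dirDeriv_coordU, map_zero]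
    rfl
  dU_u J K := ext_evalAt fun q => by
    rw [evalAt_dirDeriv_coordU]
    by_cases h : J = K
    · rw [if_pos h, h, map_one]
      exact Pi.single_eq_same _ _
    · rw [if_neg h, map_zero]
      exact Pi.single_eq_of_ne (fun h' => h (DFunLike.coe_injective h'.symm)) _
  finite_dU f := by
    obtain ⟨k, F, hF⟩ := f.2
    refine (Set.finite_Iic (equivFunOnFinite.symm fun _ : Fin n => k)).subset fun K hK i => ?_
    by_contra h
    refine hK (dirDeriv_eq_zero hV hF (truncate_single_eq_zero ?_))
    exact (not_le.1 h).trans_le (le_degree i K)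

end JetCalculus

/-! ### Comparison with the concrete operators, orders, and vertical variations. -/

namespace JetCalculus

open Finsupp MvPolynomial

variable {n : ℕ} {V : Set (Jet n)} (hV : IsOpen V)

section Restriction

variable {g : Jet n → ℝ} {f : DiffAlg V} (hg : ∀ q : V, g q = evalAt q f)
include hg

theorem lineDeriv_eq_dirDeriv (q : V) (v : Jet n) :
    lineDeriv ℝ g q v = evalAt q (dirDeriv hV v f) := by
  obtain ⟨k, F, hF⟩ := f.2
  rw [evalAt_dirDeriv hV v hF]
  exact (hF.hasLineDerivAt hV hg q v).lineDeriv

theorem partialU_eq (q : V) (K : Fin n →₀ ℕ) :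
    partialU K g q = evalAt q ((jetAlgebra hV).dU K f) :=
  lineDeriv_eq_dirDeriv hV hg q _

theorem totalD_eq (q : V) (i : Fin n) : totalD i g q = evalAt q ((jetAlgebra hV).D i f) := by
  rw [(jetAlgebra hV).D_eq i f subset_rfl, map_add, map_sum]
  refine congrArg₂ (· + ·) (lineDeriv_eq_dirDeriv hV hg q _) ?_
  rw [← finsum_comp_equiv equivFunOnFinite, finsum_eq_sum_of_support_subset (s :=
    ((jetAlgebra hV).vd f).support)]
  · refine Finset.sum_congr rfl fun K _ => ?_
    rw [map_mul]
    refine congrArg₂ (· * ·) ?_ (partialU_eq hV hg q K)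
    change (q : Jet n).2 ((K : Fin n → ℕ) + Pi.single i 1) = (q : Jet n).2 _
    rw [Finsupp.coe_add, single_eq_pi_single]
  · intro K hK
    rw [Finset.mem_coe, Finsupp.mem_support_iff]
    intro h
    refine hK ?_
    change _ * partialU K g q = 0
    rw [partialU_eq hV hg]
    change _ * evalAt q ((jetAlgebra hV).vd f K) = 0
    rw [h, map_zero, mul_zero]

theorem totalDMulti_eq (q : V) (K : Fin n →₀ ℕ) :
    totalDMulti K g q = evalAt q ((jetAlgebra hV).DD K f) := by
  have hiter (i : Fin n) (m : ℕ) {g : Jet n → ℝ} {f : DiffAlg V}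
      (hg : ∀ q : V, g q = evalAt q f) (q : V) : (totalD i)^[m] g q
        = evalAt q ((((jetAlgebra hV).D i : Module.End ℝ (DiffAlg V)) ^ m) f) := by
    induction m generalizing q with
    | zero => exact hg q
    | succ m ih =>
      rw [Function.iterate_succ_apply', pow_succ']
      exact totalD_eq hV ih q i
  unfold totalDMulti JetAlgebra.DD
  induction List.finRange n generalizing q with
  | nil => exact hg q
  | cons i l ih =>
    rw [List.map_cons, List.prod_cons]
    exact hiter i _ ih q

theorem eulerOperator_eq (q : V) :
    eulerOperator g q = evalAt q ((jetAlgebra hV).euler f) := by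
  have h1 (K : Fin n →₀ ℕ) : (-1 : ℝ) ^ deg K * totalDMulti K (partialU K g) q
      = evalAt q ((-1 : ℤ) ^ K.degree • (jetAlgebra hV).DD K ((jetAlgebra hV).dU K f)) := by
    rw [totalDMulti_eq hV (fun q => partialU_eq hV hg q K), map_zsmul, deg_coe, zsmul_eq_mul]
    push_cast
    rfl
  unfold eulerOperator JetAlgebra.euler Finsupp.sum
  rw [map_sum, ← finsum_comp_equiv equivFunOnFinite, finsum_eq_sum_of_support_subset (s :=
    ((jetAlgebra hV).vd f).support)]
  · exact Finset.sum_congr rfl fun K _ => h1 K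
  · intro K hK
    rw [Finset.mem_coe, Finsupp.mem_support_iff]
    intro h
    refine hK ((h1 K).trans ?_)
    rw [← JetAlgebra.vd_apply, h, map_zero, smul_zero, map_zero]

end Restriction

/-- The differential function `f` has order at most `k`. -/
def HasOrder (k : ℕ) (f : DiffAlg V) : Prop := ∃ F, Represents k F f.1

theorem HasOrder.mono {k l : ℕ} {f : DiffAlg V} (hf : HasOrder k f) (h : k ≤ l) :
    HasOrder l f := by
  obtain ⟨F, hF⟩ := hf
  exact ⟨_, hF.mono h⟩

theorem exists_hasOrder (f : DiffAlg V) : ∃ k, HasOrder k f := f.2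

theorem HasOrder.add {k : ℕ} {f g : DiffAlg V} (hf : HasOrder k f) (hg : HasOrder k g) :
    HasOrder k (f + g) := by
  obtain ⟨F, hF⟩ := hf
  obtain ⟨H, hH⟩ := hg
  exact ⟨_, hF.1.add hH.1, fun p => congrArg₂ (· + ·) (hF.2 p) (hH.2 p)⟩

theorem HasOrder.mul {k : ℕ} {f g : DiffAlg V} (hf : HasOrder k f) (hg : HasOrder k g) :
    HasOrder k (f * g) := by
  obtain ⟨F, hF⟩ := hf
  obtain ⟨H, hH⟩ := hg
  exact ⟨_, hF.1.mul hH.1, fun p => congrArg₂ (· * ·) (hF.2 p) (hH.2 p)⟩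

theorem hasOrder_zero (k : ℕ) : HasOrder k (0 : DiffAlg V) :=
  ⟨fun _ => 0, contDiffOn_const, fun _ => rfl⟩

theorem HasOrder.sum {ι : Type*} {k : ℕ} {f : ι → DiffAlg V} {s : Finset ι}
    (hf : ∀ i ∈ s, HasOrder k (f i)) : HasOrder k (∑ i ∈ s, f i) :=
  Finset.sum_induction f _ (fun _ _ => HasOrder.add) (hasOrder_zero k) hf

theorem HasOrder.dirDeriv {k : ℕ} {f : DiffAlg V} (hf : HasOrder k f) (v : Jet n) :
    HasOrder k (dirDeriv hV v f) := by
  obtain ⟨F, hF⟩ := hf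
  exact ⟨_, represents_dirDeriv hV v hF⟩

theorem hasOrder_coordU {k : ℕ} {K : Fin n →₀ ℕ} (hK : K.degree ≤ k) :
    HasOrder k (coordU V K) := by
  have h : HasOrder (deg K) (coordU V K) := ⟨fun z => z.2 ⟨K, le_rfl⟩, by fun_prop, fun _ => rfl⟩
  exact h.mono (by rwa [deg_coe])

theorem HasOrder.dU_eq_zero {k : ℕ} {f : DiffAlg V} (hf : HasOrder k f) {K : Fin n →₀ ℕ}
    (hK : k < K.degree) : (jetAlgebra hV).dU K f = 0 := by
  obtain ⟨F, hF⟩ := hf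
  exact dirDeriv_eq_zero hV hF (truncate_single_eq_zero hK)

theorem HasOrder.degree_le {k : ℕ} {f : DiffAlg V} (hf : HasOrder k f) {K : Fin n →₀ ℕ}
    (hK : K ∈ ((jetAlgebra hV).vd f).support) : K.degree ≤ k := by
  by_contra h
  exact Finsupp.mem_support_iff.1 hK (hf.dU_eq_zero hV (by omega))

theorem HasOrder.D {k : ℕ} {f : DiffAlg V} (hf : HasOrder k f) (i : Fin n) :
    HasOrder (k + 1) ((jetAlgebra hV).D i f) := by
  rw [(jetAlgebra hV).D_eq i f subset_rfl]
  refine ((hf.dirDeriv hV _).mono (Nat.le_succ k)).add (HasOrder.sum fun K hK => ?_)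
  refine (hasOrder_coordU ?_).mul ((hf.dirDeriv hV _).mono (Nat.le_succ k))
  rw [JetAlgebra.degree_add_single]
  have := hf.degree_le hV hK
  omega

theorem HasOrder.DD {k : ℕ} {f : DiffAlg V} (hf : HasOrder k f) (I : Fin n →₀ ℕ) :
    HasOrder (k + I.degree) ((jetAlgebra hV).DD I f) := by
  induction I using multiIndex_induction with
  | zero => simpa [JetAlgebra.DD_zero] using hf
  | add_single I i ih =>
    rw [JetAlgebra.DD_add_single, JetAlgebra.degree_add_single, ← add_assoc]
    exact ih.D hV i

theorem HasOrder.evalAt_congr {k : ℕ} {f : DiffAlg V} (hf : HasOrder k f) {p q : V}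
    (h : truncate k (p : Jet n) = truncate k (q : Jet n)) : evalAt p f = evalAt q f := by
  obtain ⟨F, hF⟩ := hf
  rw [evalAt_apply, evalAt_apply, hF.2, hF.2, h]

/-- The pairing of a covector `∑ c_K du_K` with a vertical vector. -/
def pairing (v : (Fin n → ℕ) → ℝ) : MvPolynomial (Fin n) ℝ →ₗ[ℝ] ℝ where
  toFun p := p.support.sum fun K => coeff K p * v K
  map_add' p q := by
    classical
    have h (r : MvPolynomial (Fin n) ℝ) (hr : r.support ⊆ p.support ∪ q.support) :
        (r.support.sum fun K => coeff K r * v K)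
          = (p.support ∪ q.support).sum fun K => coeff K r * v K :=
      Finset.sum_subset hr fun K _ hK => by rw [MvPolynomial.notMem_support_iff.1 hK, zero_mul]
    rw [h (p + q) MvPolynomial.support_add, h p Finset.subset_union_left, h q Finset.subset_union_right,
      ← Finset.sum_add_distrib]
    exact Finset.sum_congr rfl fun K _ => by rw [coeff_add, add_mul]
  map_smul' r p := by
    have h : ((r • p).support.sum fun K => coeff K (r • p) * v K)
          = p.support.sum fun K => coeff K (r • p) * v K :=
      Finset.sum_subset MvPolynomial.support_smul fun K _ hK => by rw [MvPolynomial.notMem_support_iff.1 hK, zero_mul]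
    rw [h, RingHom.id_apply, smul_eq_mul, Finset.mul_sum]
    exact Finset.sum_congr rfl fun K _ => by rw [coeff_smul, smul_eq_mul, mul_assoc]

theorem pairing_eq (v : (Fin n → ℕ) → ℝ) {p : MvPolynomial (Fin n) ℝ}
    {s : Finset (Fin n →₀ ℕ)} (hs : ∀ K ∉ s, coeff K p * v K = 0) :
    pairing v p = ∑ K ∈ s, coeff K p * v K := by
  classical
  change (p.support.sum fun K => coeff K p * v K) = _
  rw [Finset.sum_subset (Finset.subset_union_left (s₂ := s))
    fun K _ hK => by rw [MvPolynomial.notMem_support_iff.1 hK, zero_mul]]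
  exact (Finset.sum_subset Finset.subset_union_right fun K _ hK => hs K hK).symm

theorem pairing_evPoly_vd (f : DiffAlg V) (q : V) (v : (Fin n → ℕ) → ℝ) :
    pairing v (JetAlgebra.evPoly (evalAt q) ((jetAlgebra hV).vd f))
      = ∑ K ∈ ((jetAlgebra hV).vd f).support, evalAt q ((jetAlgebra hV).dU K f) * v K := by
  rw [pairing_eq]
  · rfl
  · intro K hK
    rw [JetAlgebra.coeff_evPoly, Finsupp.notMem_support_iff.1 hK, map_zero, zero_mul]

theorem evalAt_dirDeriv_eq (f : DiffAlg V) (q : V) (a : Fin n → ℝ) (b : (Fin n → ℕ) → ℝ) :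
    evalAt q (dirDeriv hV (a, b) f) = ∑ i, a i * evalAt q ((jetAlgebra hV).dX i f)
      + pairing b (JetAlgebra.evPoly (evalAt q) ((jetAlgebra hV).vd f)) := by
  classical
  obtain ⟨k, F, hF⟩ := f.2
  have h1 : truncate k ((a, b) : Jet n) = ∑ i, a i • truncate k ((Pi.single i 1, 0) : Jet n)
      + ∑ J : MultiIndexLE n k, b J.1 • truncate k ((0, Pi.single J.1 1) : Jet n) := by
    refine Prod.ext (funext fun j => ?_) (funext fun J => ?_)
    · simp [truncate, Prod.fst_sum, Finset.sum_apply, Pi.single_apply]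
    · simp [truncate, Prod.snd_sum, Finset.sum_apply, Pi.single_apply, Subtype.coe_inj]
  rw [evalAt_dirDeriv hV _ hF, h1, map_add, map_sum, map_sum]
  simp only [map_smul, smul_eq_mul, ← evalAt_dirDeriv hV _ hF]
  congr 1
  rw [pairing_eq (s := Finset.univ.image fun J : MultiIndexLE n k => equivFunOnFinite.symm J.1),
    Finset.sum_image]
  · exact Finset.sum_congr rfl fun J _ => mul_comm _ _
  · intro J _ K _ h
    exact Subtype.ext (equivFunOnFinite.symm.injective h)
  · intro K hK
    rw [JetAlgebra.coeff_evPoly, JetAlgebra.vd_apply, HasOrder.dU_eq_zero hV ⟨F, hF⟩, map_zero,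
      zero_mul]
    by_contra h
    exact hK (Finset.mem_image.2 ⟨⟨K, by rw [deg_coe]; omega⟩, Finset.mem_univ _,
      equivFunOnFinite.symm_apply_apply K⟩)

theorem evalAt_D (f : DiffAlg V) (q : V) (i : Fin n) :
    evalAt q ((jetAlgebra hV).D i f)
      = evalAt q (dirDeriv hV (Pi.single i 1, fun K => (q : Jet n).2 (K + Pi.single i 1)) f) := by
  rw [evalAt_dirDeriv_eq, (jetAlgebra hV).D_eq i f subset_rfl, pairing_evPoly_vd, map_add,
    map_sum]
  congr 1
  · simp [Pi.single_apply]
  · refine Finset.sum_congr rfl fun K _ => ?_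
    rw [map_mul, mul_comm, ← single_eq_pi_single, ← Finsupp.coe_add]
    rfl

theorem evalAt_u (q : V) (K : Fin n →₀ ℕ) :
    evalAt q ((jetAlgebra hV).u K) = (q : Jet n).2 K := rfl

/-- The coefficient of `du_{K,i}` is `D_i (f_{u_{K,i}}) + f_{u_K}`. Its first term vanishes when
`|K| = k`, and `v` vanishes at `u_{K,i}` when `|K| < k`. -/
theorem HasOrder.pairing_vd_D {k : ℕ} {f : DiffAlg V} (hf : HasOrder k f) (q : V)
    {v : (Fin n → ℕ) → ℝ} (hv : ∀ K : Fin n →₀ ℕ, K.degree ≤ k → v K = 0) (i : Fin n) :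
    pairing v (JetAlgebra.evPoly (evalAt q) ((jetAlgebra hV).vd ((jetAlgebra hV).D i f)))
      = ∑ K ∈ ((jetAlgebra hV).vd f).support, v (K + single i 1 : Fin n →₀ ℕ) *
        evalAt q ((jetAlgebra hV).dU K f) := by
  rw [pairing_eq (s := ((jetAlgebra hV).vd f).support.map
    ⟨fun K => K + single i 1, add_left_injective _⟩), Finset.sum_map]
  · refine Finset.sum_congr rfl fun K hK => ?_
    simp only [Function.Embedding.coeFn_mk, JetAlgebra.coeff_evPoly, JetAlgebra.vd_apply,
      JetAlgebra.dU_D_add_single]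
    have hle := hf.degree_le hV hK
    rcases hle.eq_or_lt with h | h
    · rw [hf.dU_eq_zero hV (by rw [JetAlgebra.degree_add_single]; omega), map_zero, zero_add,
        mul_comm]
    · rw [hv _ (by rw [JetAlgebra.degree_add_single]; omega), zero_mul, mul_zero]
  · intro K hK
    rcases le_or_gt K.degree k with h | h
    · rw [hv K h, mul_zero]
    · rw [JetAlgebra.coeff_evPoly, JetAlgebra.vd_apply]
      by_cases hKi : K i = 0
      · rw [JetAlgebra.dU_D_of_eq_zero _ _ _ _ hKi, hf.dU_eq_zero hV h, map_zero, map_zero,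
          zero_mul]
      · obtain ⟨J, rfl⟩ := JetAlgebra.eq_add_single hKi
        have hJ : J ∉ ((jetAlgebra hV).vd f).support := fun hJ =>
          hK (Finset.mem_map.2 ⟨J, hJ, rfl⟩)
        rw [JetAlgebra.dU_D_add_single, hf.dU_eq_zero hV h, map_zero, zero_add,
          ← JetAlgebra.vd_apply, Finsupp.notMem_support_iff.1 hJ, map_zero, zero_mul]

/-- Changing the coordinates of order `k + 1` and above changes the total derivative of a
differential function of order `k` affinely. -/
theorem HasOrder.evalAt_D_add {k : ℕ} {f : DiffAlg V} (hf : HasOrder k f) {q q' : V}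
    {v : (Fin n → ℕ) → ℝ} (hv : ∀ K : Fin n →₀ ℕ, K.degree ≤ k → v K = 0)
    (hq : (q' : Jet n) = (q : Jet n) + (0, v)) (i : Fin n) :
    evalAt q' ((jetAlgebra hV).D i f) = evalAt q ((jetAlgebra hV).D i f)
      + pairing v (JetAlgebra.evPoly (evalAt q) ((jetAlgebra hV).vd ((jetAlgebra hV).D i f))) := by
  have htr : truncate k (q' : Jet n) = truncate k (q : Jet n) := by
    rw [hq]
    refine Prod.ext (by simp [truncate]) (funext fun J => ?_)
    have := hv (equivFunOnFinite.symm J.1) (by rw [← deg_coe]; exact J.2)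
    simpa [truncate] using this
  have hX : evalAt q' ((jetAlgebra hV).dX i f) = evalAt q ((jetAlgebra hV).dX i f) :=
    (hf.dirDeriv hV _).evalAt_congr htr
  have hU (K : Fin n →₀ ℕ) :
      evalAt q' ((jetAlgebra hV).dU K f) = evalAt q ((jetAlgebra hV).dU K f) :=
    (hf.dirDeriv hV _).evalAt_congr htr
  have hu (K : Fin n →₀ ℕ) : (q' : Jet n).2 K = (q : Jet n).2 K + v K := by
    rw [hq]
    rfl
  rw [hf.pairing_vd_D hV q hv, (jetAlgebra hV).D_eq i f subset_rfl]
  simp only [map_add, map_sum, map_mul, evalAt_u, hX, hU, add_assoc, ← Finset.sum_add_distrib,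
    ← add_mul]
  congr 1
  refine Finset.sum_congr rfl fun K _ => ?_
  rw [hu]

end JetCalculus

/-! ### Extension of finite-order solutions and Lagrange multipliers. -/

namespace JetCalculus

open Finsupp MvPolynomial

namespace JetAlgebra

variable {n : ℕ} {A : Type*} [CommRing A] [Algebra ℝ A] {S : JetAlgebra n A} {G : A} {N : ℕ}

theorem symbolMatrix_map_apply (ev : A →ₐ[ℝ] ℝ) {r j : ℕ} (hj : j = r + N)
    (K : {K : Fin n →₀ ℕ // K.degree = j}) (I : {I : Fin n →₀ ℕ // I.degree = r}) :
    ev (symbolMatrix S G r j K I) = coeff K.1 (monomial I.1 1 * symbol S G N ev) := by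
  classical
  have := symbolMatrix_map_mulVec (S := S) (G := G) ev hj (Pi.single I 1) K
  rw [Matrix.mulVec_single_one] at this
  refine this.trans ?_
  congr 2
  rw [Finset.sum_eq_single I]
  · rw [Pi.single_eq_same]
  · intro J _ hJ
    rw [Pi.single_eq_of_ne hJ, map_zero]
  · simp

/-- The top order part of the prolonged linearized equation can be solved with arbitrary right-hand
sides. -/
theorem exists_pairing_eq (hord : ∀ J : Fin n →₀ ℕ, N < J.degree → S.dU J G = 0)
    {ev : A →ₐ[ℝ] ℝ} (hs : symbol S G N ev ≠ 0) (r : ℕ)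
    (t : {I : Fin n →₀ ℕ // I.degree = r} → ℝ) :
    ∃ v : (Fin n → ℕ) → ℝ, (∀ K : Fin n →₀ ℕ, K.degree ≠ r + N → v K = 0) ∧
      ∀ I, pairing v (evPoly ev (S.vd (S.DD I.1 G))) = t I := by
  classical
  set M := (symbolMatrix S G r (r + N)).map ev with hM
  have hdet : IsUnit (M.transpose * M).det := by
    rw [isUnit_iff_ne_zero]
    intro h
    obtain ⟨a, ha, ha'⟩ := Matrix.exists_mulVec_eq_zero_iff.2 h
    have h1 : a ∈ LinearMap.ker (M.transpose * M).mulVecLin := ha'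
    rw [Matrix.ker_mulVecLin_transpose_mul_self] at h1
    exact ha (symbolMatrix_map_mulVec_injective rfl hs h1)
  -- Since `M` is injective, its transpose is surjective, with right inverse `M (MᵀM)⁻¹`.
  set w := M.mulVec ((M.transpose * M)⁻¹.mulVec t) with hw
  have hMw : M.transpose.mulVec w = t := by
    rw [hw, Matrix.mulVec_mulVec, Matrix.mulVec_mulVec, Matrix.mul_nonsing_inv _ hdet,
      Matrix.one_mulVec]
  set v : (Fin n → ℕ) → ℝ := fun J =>
    if h : (equivFunOnFinite.symm J).degree = r + N then w ⟨_, h⟩ else 0 with hv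
  have hv1 (K : Fin n →₀ ℕ) (hK : K.degree = r + N) : v K = w ⟨K, hK⟩ := by
    simp only [hv, equivFunOnFinite_symm_coe]
    exact dif_pos hK
  have hv0 (K : Fin n →₀ ℕ) (hK : K.degree ≠ r + N) : v K = 0 := by
    simp only [hv, equivFunOnFinite_symm_coe]
    exact dif_neg hK
  refine ⟨v, hv0, fun I => ?_⟩
  rw [pairing_eq (s := (Finset.univ : Finset {K : Fin n →₀ ℕ // K.degree = r + N}).map
    (Function.Embedding.subtype _)), Finset.sum_map]
  · refine Eq.trans ?_ (congrFun hMw I)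
    refine Finset.sum_congr rfl fun K _ => ?_
    rw [Function.Embedding.subtype_apply, hv1 K.1 K.2,
      coeff_evPoly_vd_DD hord ev I.1 K.1 (by rw [I.2, K.2]; omega),
      ← symbolMatrix_map_apply ev rfl K I]
    rfl
  · intro K hK
    rw [hv0 K, mul_zero]
    intro h
    exact hK (Finset.mem_map.2 ⟨⟨K, h⟩, Finset.mem_univ _, rfl⟩)

end JetAlgebra

variable {n : ℕ} {V : Set (Jet n)} (hV : IsOpen V)

/-- A formal solution up to order `m` agrees up to order `m` with one up to order `m + 1`. -/
theorem exists_solution_succ {G : DiffAlg V} {N m₀ m : ℕ} (hG : HasOrder N G)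
    (hcyl : ∀ p q : Jet n, truncate m₀ p = truncate m₀ q → p ∈ V → q ∈ V)
    (hs : ∀ q : V, JetAlgebra.symbol (jetAlgebra hV) G N (evalAt q) ≠ 0)
    (hm : m₀ ≤ m) (hmN : N ≤ m) (q : V)
    (hq : ∀ I : Fin n →₀ ℕ, I.degree + N ≤ m → evalAt q ((jetAlgebra hV).DD I G) = 0) :
    ∃ q' : V, truncate m (q' : Jet n) = truncate m (q : Jet n) ∧
      ∀ I : Fin n →₀ ℕ, I.degree + N ≤ m + 1 → evalAt q' ((jetAlgebra hV).DD I G) = 0 := by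
  obtain ⟨r, rfl⟩ := Nat.exists_eq_add_of_le' hmN
  -- The equations still to be solved, `D_I G = 0` with `|I| = r + 1`, are affine in the coordinates
  -- of order `r + 1 + N`. Changing only these leaves the earlier equations intact, and `v` is
  -- chosen to cancel the present values.
  obtain ⟨v, hv0, hv⟩ := JetAlgebra.exists_pairing_eq (fun _ => hG.dU_eq_zero hV) (hs q) (r + 1)
    (fun I => - evalAt q ((jetAlgebra hV).DD I.1 G))
  have htr {l : ℕ} (hl : l ≤ r + N) :
      truncate l ((q : Jet n) + (0, v)) = truncate l (q : Jet n) := by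
    refine Prod.ext (by simp [truncate]) (funext fun J => ?_)
    have := hv0 (equivFunOnFinite.symm J.1) (by
      have := J.2
      rw [← deg_coe]
      change deg J.1 ≠ _
      omega)
    simpa [truncate] using this
  refine ⟨⟨(q : Jet n) + (0, v), hcyl q _ (htr hm).symm q.2⟩, htr le_rfl, fun I hI => ?_⟩
  rcases Nat.lt_or_ge r I.degree with h | h
  · have hI' : I.degree = r + 1 := by omega
    have hne : I ≠ 0 := by
      rintro rfl
      simp at hI'
    obtain ⟨i, hi⟩ := Finsupp.ne_iff.1 hne
    obtain ⟨J, rfl⟩ := JetAlgebra.eq_add_single hi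
    have hJ : J.degree = r := by
      rw [JetAlgebra.degree_add_single] at hI'
      omega
    have h1 := hv ⟨_, hI'⟩
    rw [JetAlgebra.DD_add_single] at h1 ⊢
    rw [(hG.DD hV J).evalAt_D_add hV (q := q) (v := v) (fun K hK => hv0 K (by omega)) rfl i, h1,
      add_neg_cancel]
  · rw [← hq I (by omega)]
    exact (hG.DD hV I).evalAt_congr (htr (by omega))

/-- A formal solution of finite order is the truncation of a formal solution. -/
theorem exists_solution_truncate_eq {G : DiffAlg V} {N m₀ k : ℕ} (hG : HasOrder N G)
    (hcyl : ∀ p q : Jet n, truncate m₀ p = truncate m₀ q → p ∈ V → q ∈ V)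
    (hs : ∀ q : V, JetAlgebra.symbol (jetAlgebra hV) G N (evalAt q) ≠ 0)
    (hk : m₀ ≤ k) (hkN : N ≤ k) (q₀ : V)
    (hq₀ : ∀ I : Fin n →₀ ℕ, I.degree + N ≤ k → evalAt q₀ ((jetAlgebra hV).DD I G) = 0) :
    ∃ q : V, truncate k (q : Jet n) = truncate k (q₀ : Jet n) ∧
      ∀ I, evalAt q ((jetAlgebra hV).DD I G) = 0 := by
  let Sol (j : ℕ) := {q : V // ∀ I : Fin n →₀ ℕ, I.degree + N ≤ k + j →
    evalAt q ((jetAlgebra hV).DD I G) = 0}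
  have hstep (j : ℕ) (q : Sol j) : ∃ q' : Sol (j + 1),
      truncate (k + j) (q'.1 : Jet n) = truncate (k + j) (q.1 : Jet n) := by
    obtain ⟨q', h1, h2⟩ := exists_solution_succ hV hG hcyl hs (m := k + j) (by omega) (by omega)
      q.1 q.2
    exact ⟨⟨q', h2⟩, h1⟩
  choose next hnext using hstep
  let Q : ∀ j, Sol j := fun j => Nat.rec ⟨q₀, hq₀⟩ next j
  have hQ (j : ℕ) : truncate (k + j) ((Q (j + 1)).1 : Jet n)
      = truncate (k + j) ((Q j).1 : Jet n) := hnext j (Q j)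
  have hQ' (i j : ℕ) : truncate (k + i) ((Q (i + j)).1 : Jet n)
      = truncate (k + i) ((Q i).1 : Jet n) := by
    induction j with
    | zero => rfl
    | succ j ih =>
      exact (congrArg (restrictL n (by omega : k + i ≤ k + (i + j))) (hQ (i + j))).trans ih
  have hcoord {i j : ℕ} {J : Fin n → ℕ} (h : i ≤ j) (hJ : deg J ≤ k + i) :
      ((Q j).1 : Jet n).2 J = ((Q i).1 : Jet n).2 J := by
    obtain ⟨l, rfl⟩ := Nat.exists_eq_add_of_le h
    exact congrFun (congrArg Prod.snd (hQ' i l)) ⟨J, hJ⟩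
  -- The coordinate `u_J` no longer changes from stage `deg J` on, because `deg J ≤ k + deg J`.
  set q : Jet n := (q₀.1.1, fun J => ((Q (deg J)).1 : Jet n).2 J) with hq
  have htr (j : ℕ) : truncate (k + j) q = truncate (k + j) ((Q j).1 : Jet n) := by
    refine Prod.ext ?_ (funext fun J => ?_)
    · have := congrArg Prod.fst (hQ' 0 j)
      rw [zero_add] at this
      exact this.symm
    · change ((Q (deg J.1)).1 : Jet n).2 J.1 = ((Q j).1 : Jet n).2 J.1
      rcases le_total (deg J.1) j with h | h
      · exact (hcoord h (by omega)).symm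
      · exact hcoord h J.2
  have hqV : q ∈ V := by
    refine hcyl q₀ q ?_ q₀.2
    rw [← restrictL_truncate hk, ← restrictL_truncate hk]
    exact congrArg _ (htr 0).symm
  refine ⟨⟨q, hqV⟩, htr 0, fun I => ?_⟩
  rw [← (Q I.degree).2 I (by omega)]
  refine (hG.DD hV I).evalAt_congr ?_
  change truncate _ q = _
  rw [← restrictL_truncate (by omega : N + I.degree ≤ k + I.degree), htr, restrictL_truncate]

/-- The formal solutions in `V` of `G = 0`. -/
def solutionSet (G : DiffAlg V) : Set V := {q | ∀ I, evalAt q ((jetAlgebra hV).DD I G) = 0}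

theorem evPoly_vd_eq_prolongation {G : DiffAlg V} {q : V} {c : (Fin n →₀ ℕ) →₀ ℝ}
    {f : DiffAlg V} (h : ∀ v, evalAt q (dirDeriv hV v f)
      = c.sum fun I a => a * evalAt q (dirDeriv hV v ((jetAlgebra hV).DD I G))) :
    JetAlgebra.evPoly (evalAt q) ((jetAlgebra hV).vd f)
      = JetAlgebra.prolongation (jetAlgebra hV) G (evalAt q) c := by
  ext K
  rw [JetAlgebra.prolongation, linearCombination_apply, Finsupp.sum, coeff_sum]
  exact h (0, Pi.single K 1)

/-- A differential function vanishing on the formal solutions has its differential in the span of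
the differentials of the `D_I G`. -/
theorem exists_multipliers {G : DiffAlg V} {N m₀ : ℕ} (hN : 1 ≤ N) (hG : HasOrder N G)
    (hcyl : ∀ p q : Jet n, truncate m₀ p = truncate m₀ q → p ∈ V → q ∈ V)
    (hs : ∀ q : V, JetAlgebra.symbol (jetAlgebra hV) G N (evalAt q) ≠ 0) {f : DiffAlg V}
    (hf : ∀ q ∈ solutionSet hV G, evalAt q f = 0) {q : V} (hq : q ∈ solutionSet hV G) :
    ∃ c : (Fin n →₀ ℕ) →₀ ℝ, ∀ v, evalAt q (dirDeriv hV v f)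
      = c.sum fun I a => a * evalAt q (dirDeriv hV v ((jetAlgebra hV).DD I G)) := by
  classical
  obtain ⟨l, hl⟩ := exists_hasOrder f
  obtain ⟨k, hk1, hk2, hk3⟩ : ∃ k, l ≤ k ∧ m₀ ≤ k ∧ N ≤ k := ⟨l + m₀ + N, by omega⟩
  obtain ⟨F, hF⟩ := hl.mono hk1
  let ι := {I : Fin n →₀ ℕ // I.degree ≤ k - N}
  have hfin : Finite ι := by
    refine Finite.of_injective (β := MultiIndexLE n (k - N))
      (fun I => ⟨I.1, by rw [deg_coe]; exact I.2⟩) fun I J h => ?_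
    exact Subtype.ext (DFunLike.coe_injective (congrArg Subtype.val h))
  have := Fintype.ofFinite ι
  have hrep (I : ι) : ∃ Φ, Represents k Φ ((jetAlgebra hV).DD I.1 G).1 :=
    (hG.DD hV I.1).mono (by have := I.2; omega)
  choose Φ hΦ using hrep
  set z₀ := truncate k (q : Jet n) with hz₀
  have hopen : truncate k '' V ∈ 𝓝 z₀ := (isOpen_truncate_image hV k).mem_nhds ⟨q, q.2, rfl⟩
  have hstrict {H : FiniteJet n k → ℝ} {h : DiffAlg V} (hH : Represents k H h.1) :
      HasStrictFDerivAt H (fderiv ℝ H z₀) z₀ :=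
    (hH.1.contDiffAt hopen).hasStrictFDerivAt (by simp)
  -- Points satisfying the equations up to order `k` extend to formal solutions, where `f` vanishes.
  -- So `F` is constantly zero on the constraint set near `z₀`, and is trivially extremal there.
  have hext : IsLocalExtrOn F {z | ∀ I, Φ I z = Φ I z₀} z₀ := by
    refine Or.inl ?_
    filter_upwards [mem_nhdsWithin_of_mem_nhds hopen, self_mem_nhdsWithin]
    rintro _ ⟨p, hp, rfl⟩ hz
    have h1 (I : Fin n →₀ ℕ) (hI : I.degree + N ≤ k) :
        evalAt ⟨p, hp⟩ ((jetAlgebra hV).DD I G) = 0 := by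
      have h2 := hz ⟨I, by omega⟩
      rw [← (hΦ ⟨I, by omega⟩).2 ⟨p, hp⟩, hz₀, ← (hΦ ⟨I, by omega⟩).2 q] at h2
      exact h2.trans (hq I)
    obtain ⟨p', hp', hsol⟩ := exists_solution_truncate_eq hV hG hcyl hs hk2 hk3 ⟨p, hp⟩ h1
    have h3 : F (truncate k p) = 0 := by
      have := hf p' hsol
      rw [evalAt_apply, hF.2, hp'] at this
      exact this
    have h4 : F z₀ = 0 := by
      have := hf q hq
      rwa [evalAt_apply, hF.2] at this
    rw [h3, h4]
  obtain ⟨Λ, Λ₀, hne, hΛ⟩ := hext.exists_multipliers_of_hasStrictFDerivAt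
    (fun I => hstrict (hΦ I)) (hstrict hF)
  have hsum (Λ : ι → ℝ) (v : Jet n) :
      (∑ I : ι, single I.1 (Λ I)).sum (fun I a => a * evalAt q (dirDeriv hV v
        ((jetAlgebra hV).DD I G))) = ∑ I, Λ I * fderiv ℝ (Φ I) z₀ (truncate k v) := by
    rw [← Finsupp.sum_finsetSum_index (by simp) (by intros; ring)]
    refine Finset.sum_congr rfl fun I _ => ?_
    rw [sum_single_index (by simp), evalAt_dirDeriv hV v (hΦ I)]
  have hrel (v : Jet n) : ∑ I, Λ I * fderiv ℝ (Φ I) z₀ (truncate k v)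
      + Λ₀ * fderiv ℝ F z₀ (truncate k v) = 0 := by
    have := DFunLike.congr_fun hΛ (truncate k v)
    simpa using this
  -- Otherwise the multipliers would be a nontrivial linear relation among the `d(D_I G)`.
  have hΛ₀ : Λ₀ ≠ 0 := by
    intro h0
    have h1 : JetAlgebra.prolongation (jetAlgebra hV) G (evalAt q)
        (∑ I : ι, single I.1 (Λ I)) = 0 := by
      rw [← evPoly_vd_eq_prolongation hV (f := 0) (fun v => ?_), map_zero]
      · ext K; simp
      · rw [hsum Λ, map_zero, map_zero]
        have := hrel v
        rw [h0, zero_mul, add_zero] at this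
        exact this.symm
    have h2 := JetAlgebra.eq_zero_of_coeff_prolongation_eq_zero (fun _ => hG.dU_eq_zero hV) (hs q) (m := 0)
      (fun K _ => by rw [h1, coeff_zero])
    refine hne (Prod.ext (funext fun I => ?_) h0)
    have h3 := h2 I.1 (by omega)
    rw [Finsupp.finsetSum_apply, Finset.sum_eq_single I, single_eq_same] at h3
    · exact h3
    · intro J _ hJ
      exact single_eq_of_ne' fun h => hJ (Subtype.ext h)
    · simp
  refine ⟨∑ I : ι, single I.1 (-Λ I / Λ₀), fun v => ?_⟩
  rw [hsum (fun I => -Λ I / Λ₀), evalAt_dirDeriv hV v hF]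
  have h1 : ∑ I, -Λ I / Λ₀ * fderiv ℝ (Φ I) z₀ (truncate k v)
      = -(∑ I, Λ I * fderiv ℝ (Φ I) z₀ (truncate k v)) / Λ₀ := by
    rw [← Finset.sum_neg_distrib, Finset.sum_div]
    exact Finset.sum_congr rfl fun I _ => by ring
  rw [h1, eq_div_iff hΛ₀]
  linarith [hrel v]

/-- At a point, `D_i` is the derivative along a fixed vector, so it passes through the relation and
meets `D_i D_I G = 0`. -/
theorem evalAt_D_eq_zero_of_multipliers {G f : DiffAlg V} {q : V} (hq : q ∈ solutionSet hV G)
    {c : (Fin n →₀ ℕ) →₀ ℝ} (hc : ∀ v, evalAt q (dirDeriv hV v f)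
      = c.sum fun I a => a * evalAt q (dirDeriv hV v ((jetAlgebra hV).DD I G))) (i : Fin n) :
    evalAt q ((jetAlgebra hV).D i f) = 0 := by
  rw [evalAt_D, hc]
  refine Finset.sum_eq_zero fun I _ => ?_
  simp only [← evalAt_D, ← JetAlgebra.DD_add_single]
  rw [hq, mul_zero]

/-- If the total derivatives of `W` vanish on the formal solutions, then so does the restriction of
its differential to the vectors tangent to them. -/
theorem exists_multipliers_of_D_eq_zero (hn : 2 ≤ n) {G W : DiffAlg V} {N m₀ : ℕ} (hN : 1 ≤ N)
    (hG : HasOrder N G)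
    (hcyl : ∀ p q : Jet n, truncate m₀ p = truncate m₀ q → p ∈ V → q ∈ V)
    (hs : ∀ q : V, JetAlgebra.symbol (jetAlgebra hV) G N (evalAt q) ≠ 0)
    (hW : ∀ q ∈ solutionSet hV G, ∀ i, evalAt q ((jetAlgebra hV).D i W) = 0) {q : V}
    (hq : q ∈ solutionSet hV G) :
    ∃ c : (Fin n →₀ ℕ) →₀ ℝ, ∀ v, evalAt q (dirDeriv hV v W)
      = c.sum fun I a => a * evalAt q (dirDeriv hV v ((jetAlgebra hV).DD I G)) := by
  have hmult {f : DiffAlg V} (hf : ∀ q ∈ solutionSet hV G, evalAt q f = 0) {q : V}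
    (hq : q ∈ solutionSet hV G) := exists_multipliers hV hN hG hcyl hs hf hq
  obtain ⟨k, hk⟩ := exists_hasOrder W
  obtain ⟨c, hc⟩ := JetAlgebra.evPoly_mem_range_prolongation hn (fun _ => hG.dU_eq_zero hV) evalAt
    (solutionSet hV G) (fun a => isUnit_of_evalAt_ne_zero) hs
    (fun f hf q hq i => by
      obtain ⟨c, hc⟩ := hmult hf hq
      exact evalAt_D_eq_zero_of_multipliers hV hq hc i)
    (k + 1) ((jetAlgebra hV).vd W)
    (fun q _ K hK => by
      rw [JetAlgebra.vd_apply, hk.dU_eq_zero hV (by omega), map_zero])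
    (fun i q hq => by
      obtain ⟨c, hc⟩ := hmult (fun q hq => hW q hq i) hq
      rw [← JetAlgebra.vd_D]
      exact ⟨c, (evPoly_vd_eq_prolongation hV hc).symm⟩) q hq
  refine ⟨c, fun v => ?_⟩
  -- When all `D_i f` vanish at `q`, subtracting the total directions `∑ v^i D_i` from `v` does not
  -- change the derivative and leaves a vertical vector. This applies to `W` and to each `D_I G`, so
  -- the relation between vertical differentials becomes one between full differentials.
  have hdecomp (f : DiffAlg V) (hf : ∀ i, evalAt q ((jetAlgebra hV).D i f) = 0) :
      evalAt q (dirDeriv hV v f) = pairing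
        (fun K => v.2 K - ∑ i, v.1 i * (q : Jet n).2 (K + Pi.single i 1))
        (JetAlgebra.evPoly (evalAt q) ((jetAlgebra hV).vd f)) := by
    have h1 (i : Fin n) : evalAt q ((jetAlgebra hV).dX i f)
        = -∑ K ∈ ((jetAlgebra hV).vd f).support, evalAt q ((jetAlgebra hV).dU K f)
          * (q : Jet n).2 ((K : Fin n → ℕ) + Pi.single i 1) := by
      have h2 := hf i
      rw [evalAt_D, evalAt_dirDeriv_eq, pairing_evPoly_vd] at h2
      rw [eq_neg_iff_add_eq_zero, ← h2]
      congr 1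
      simp [Pi.single_apply]
    rw [show v = (v.1, v.2) from rfl, evalAt_dirDeriv_eq, pairing_evPoly_vd, pairing_evPoly_vd]
    simp only [h1, mul_sub, Finset.sum_sub_distrib, Finset.mul_sum, mul_neg,
      Finset.sum_neg_distrib]
    rw [Finset.sum_comm, add_comm, ← sub_eq_add_neg]
    congr 1
    refine Finset.sum_congr rfl fun K _ => Finset.sum_congr rfl fun i _ => by ring
  rw [hdecomp W (hW q hq), ← hc, JetAlgebra.prolongation, linearCombination_apply, map_finsuppSum]
  refine Finset.sum_congr rfl fun I _ => ?_
  change pairing _ (c I • _) = c I * _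
  rw [map_smul, smul_eq_mul, hdecomp _ fun i => ?_]
  rw [← JetAlgebra.DD_add_single]
  exact hq _

end JetCalculus

/-! ### Local constancy on level sets of submersions. -/

namespace JetCalculus

open Filter

section LevelSet

variable {E : Type*} [NormedAddCommGroup E] [NormedSpace ℝ E] {ι : Type*} [Fintype ι]

/-- A proper range would lie in the kernel of a nonzero functional, whose coefficients give a linear
relation. -/
theorem surjective_pi_of_linearIndependent {L : ι → E →L[ℝ] ℝ}
    (hL : ∀ c : ι → ℝ, (∀ v, ∑ i, c i * L i v = 0) → c = 0) :
    Function.Surjective (ContinuousLinearMap.pi L) := by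
  classical
  by_contra h
  have h1 : LinearMap.range (ContinuousLinearMap.pi L : E →ₗ[ℝ] ι → ℝ) < ⊤ :=
    lt_top_iff_ne_top.2 fun h' => h (LinearMap.range_eq_top.1 h')
  obtain ⟨φ, hφ, hker⟩ := Submodule.exists_le_ker_of_lt_top _ h1
  apply hφ
  have h2 := hL (fun i => φ fun j => if i = j then 1 else 0) fun v => by
    have h3 : φ (ContinuousLinearMap.pi L v) = 0 := hker ⟨v, rfl⟩
    rw [LinearMap.pi_apply_eq_sum_univ] at h3
    exact Eq.trans (Finset.sum_congr rfl fun i _ => mul_comm _ _) h3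
  refine LinearMap.ext fun x => ?_
  rw [LinearMap.pi_apply_eq_sum_univ]
  exact Finset.sum_eq_zero fun i _ => by
    have := congrFun h2 i
    simp only [Pi.zero_apply] at this
    rw [this, smul_zero]

/-- A function whose differential vanishes on the tangent spaces of a level set of a submersion is
locally constant on the level set. -/
theorem eventually_eq_of_fderiv_eq_zero_on_ker [FiniteDimensional ℝ E] {Φ : ι → E → ℝ} {F : E → ℝ} {z₀ : E} {O : Set E}
    (hO : IsOpen O) (hz₀ : z₀ ∈ O) (hΦ : ∀ i, ContDiffOn ℝ 1 (Φ i) O) (hF : ContDiffOn ℝ 1 F O)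
    (hΦ₀ : ∀ i, Φ i z₀ = 0)
    (hli : ∀ c : ι → ℝ, (∀ v, ∑ i, c i * fderiv ℝ (Φ i) z₀ v = 0) → c = 0)
    (h : ∀ z ∈ O, (∀ i, Φ i z = 0) → ∀ v, (∀ i, fderiv ℝ (Φ i) z v = 0) → fderiv ℝ F z v = 0) :
    ∀ᶠ z in 𝓝 z₀, (∀ i, Φ i z = 0) → F z = F z₀ := by
  have : CompleteSpace E := FiniteDimensional.complete ℝ E
  set L : E →L[ℝ] ι → ℝ := ContinuousLinearMap.pi fun i => fderiv ℝ (Φ i) z₀ with hL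
  have hsurj : Function.Surjective L := surjective_pi_of_linearIndependent hli
  set K := LinearMap.ker (L : E →ₗ[ℝ] ι → ℝ) with hK
  obtain ⟨π, hπ⟩ := Submodule.ClosedComplemented.of_finiteDimensional (𝕜 := ℝ) K
  have hbij : Function.Bijective (L.prod π) := by
    constructor
    · rw [injective_iff_map_eq_zero]
      intro x hx
      have h1 : L x = 0 := congrArg Prod.fst hx
      have h2 : π x = 0 := congrArg Prod.snd hx
      have h3 := hπ ⟨x, h1⟩
      change π x = _ at h3
      rw [h2] at h3
      exact (congrArg Subtype.val h3).symm
    · rintro ⟨a, b⟩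
      obtain ⟨x, rfl⟩ := hsurj a
      refine ⟨x - π x + b, Prod.ext ?_ ?_⟩
      · change L (x - π x + b) = L x
        have h1 : L (π x : E) = 0 := (π x).2
        have h2 : L (b : E) = 0 := b.2
        rw [map_add, map_sub, h1, h2, sub_zero, add_zero]
      · change π (x - π x + b) = b
        rw [map_add, map_sub, hπ, hπ, sub_self, zero_add]
  set e : E ≃L[ℝ] (ι → ℝ) × K := ContinuousLinearEquiv.ofBijective (L.prod π)
    (LinearMap.ker_eq_bot.2 hbij.1) (LinearMap.range_eq_top.2 hbij.2) with he
  -- Completing the `Φ i` by a projection onto the kernel of their differential gives a local chart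
  -- in which the zero level is the slice `{0} × K`.
  set Ψ : E → (ι → ℝ) × K := fun z => (fun i => Φ i z, π z) with hΨ
  have hΦc (i : ι) : ContDiffAt ℝ 1 (Φ i) z₀ := (hΦ i).contDiffAt (hO.mem_nhds hz₀)
  have hΨc : ContDiffAt ℝ 1 Ψ z₀ :=
    (contDiffAt_pi.2 hΦc).prodMk π.contDiff.contDiffAt
  have hΨd : HasFDerivAt Ψ (e : E →L[ℝ] (ι → ℝ) × K) z₀ := by
    have h1 : HasFDerivAt Ψ (L.prod π) z₀ :=
      (hasFDerivAt_pi.2 fun i => ((hΦc i).differentiableAt one_ne_zero).hasFDerivAt).prodMk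
        π.hasFDerivAt
    exact h1
  have hone : (1 : WithTop ℕ∞) ≠ 0 := one_ne_zero
  set P := hΨc.toOpenPartialHomeomorph Ψ hΨd hone with hP
  have hsrc : z₀ ∈ P.source := hΨc.mem_toOpenPartialHomeomorph_source hΨd hone
  have htgt : Ψ z₀ ∈ P.target := hΨc.image_mem_toOpenPartialHomeomorph_target hΨd hone
  have hsymm : ContDiffAt ℝ 1 P.symm (Ψ z₀) := hΨc.to_localInverse hΨd hone
  have hsymm₀ : P.symm (Ψ z₀) = z₀ := P.left_inv hsrc
  have hev : ∀ᶠ y in 𝓝 (Ψ z₀), y ∈ P.target ∧ P.symm y ∈ O ∧ ContDiffAt ℝ 1 P.symm y := by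
    refine (P.open_target.eventually_mem htgt).and (Filter.Eventually.and ?_ ?_)
    · exact hsymm.continuousAt.preimage_mem_nhds (by rw [hsymm₀]; exact hO.mem_nhds hz₀)
    · exact hsymm.eventually (by simp)
  obtain ⟨ε, hε, hball⟩ := Metric.eventually_nhds_iff_ball.1 hev
  have hzero : Ψ z₀ = (0, π z₀) := Prod.ext (funext hΦ₀) rfl
  have hmem {t : K} (ht : t ∈ Metric.ball (π z₀) ε) :
      ((0, t) : (ι → ℝ) × K) ∈ Metric.ball (Ψ z₀) ε := by
    rw [Metric.mem_ball, hzero, Prod.dist_eq, dist_self]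
    exact max_lt hε ht
  have hright {y : (ι → ℝ) × K} (hy : y ∈ Metric.ball (Ψ z₀) ε) : Ψ (P.symm y) = y :=
    P.right_inv (hball y hy).1
  have hderiv (t : K) (ht : t ∈ Metric.ball (π z₀) ε) :
      HasFDerivAt (fun t : K => F (P.symm (0, t))) (0 : K →L[ℝ] ℝ) t := by
    obtain ⟨-, hyO, hyc⟩ := hball _ (hmem ht)
    set y : (ι → ℝ) × K := (0, t) with hy
    have hd := (hyc.differentiableAt one_ne_zero).hasFDerivAt
    have hinr : HasFDerivAt (fun t : K => ((0, t) : (ι → ℝ) × K))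
        (ContinuousLinearMap.inr ℝ (ι → ℝ) K) t := (ContinuousLinearMap.inr ℝ (ι → ℝ) K).hasFDerivAt
    have hFd : HasFDerivAt F (fderiv ℝ F (P.symm y)) (P.symm y) :=
      ((hF.contDiffAt (hO.mem_nhds hyO)).differentiableAt one_ne_zero).hasFDerivAt
    have hcomp := (HasFDerivAt.comp (g := F) y hFd hd).comp t hinr
    refine hcomp.congr_fderiv (ContinuousLinearMap.ext fun τ => ?_)
    -- The curve directions in the slice keep every `Φ i` equal to zero, so their images lie in all
    -- the kernels to which `h` refers.
    refine h _ hyO (fun i => congrFun (congrArg Prod.fst (hright (hmem ht))) i) _ fun i => ?_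
    have hΦd : HasFDerivAt (Φ i) (fderiv ℝ (Φ i) (P.symm y)) (P.symm y) :=
      (((hΦ i).contDiffAt (hO.mem_nhds hyO)).differentiableAt one_ne_zero).hasFDerivAt
    have hcomp' := (HasFDerivAt.comp (g := Φ i) y hΦd hd).comp t hinr
    have hconst : (Φ i ∘ P.symm) ∘ (fun t : K => ((0, t) : (ι → ℝ) × K)) =ᶠ[𝓝 t] fun _ => 0 := by
      filter_upwards [Metric.isOpen_ball.mem_nhds ht] with s hs
      exact congrFun (congrArg Prod.fst (hright (hmem hs))) i
    have huniq := hcomp'.unique ((hasFDerivAt_const (0 : ℝ) t).congr_of_eventuallyEq hconst)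
    exact DFunLike.congr_fun huniq τ
  have hπnear : ∀ᶠ z in 𝓝 z₀, π z ∈ Metric.ball (π z₀) ε :=
    π.continuous.continuousAt.preimage_mem_nhds (Metric.ball_mem_nhds _ hε)
  filter_upwards [P.open_source.mem_nhds hsrc, hπnear] with z hz hzε hΦz
  have h1 : F (P.symm (0, π z)) = F (P.symm (0, π z₀)) :=
    Metric.isOpen_ball.is_const_of_fderiv_eq_zero (𝕜 := ℝ)
      (f := fun t : K => F (P.symm (0, t))) (convex_ball (π z₀) ε).isPreconnected
      (fun t ht => (hderiv t ht).differentiableAt.differentiableWithinAt)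
      (fun t ht => (hderiv t ht).fderiv) hzε (Metric.mem_ball_self hε)
  have h2 : P.symm (0, π z) = z := by
    have : Ψ z = (0, π z) := Prod.ext (funext hΦz) rfl
    rw [← this]
    exact P.left_inv hz
  rw [h2, ← hzero, hsymm₀] at h1
  exact h1

end LevelSet

/-! ### Local constancy on the formal solutions. -/

open Finsupp MvPolynomial

variable {n : ℕ} {V : Set (Jet n)} (hV : IsOpen V)

/-- A differential function whose total derivatives vanish on the formal solutions is locally
constant on them. -/
theorem eventually_evalAt_eq (hn : 2 ≤ n) {G W : DiffAlg V} {N m₀ : ℕ} (hN : 1 ≤ N)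
    (hG : HasOrder N G)
    (hcyl : ∀ p q : Jet n, truncate m₀ p = truncate m₀ q → p ∈ V → q ∈ V)
    (hs : ∀ q : V, JetAlgebra.symbol (jetAlgebra hV) G N (evalAt q) ≠ 0)
    (hW : ∀ q ∈ solutionSet hV G, ∀ i, evalAt q ((jetAlgebra hV).D i W) = 0) {p : V}
    (hp : p ∈ solutionSet hV G) :
    ∀ᶠ q : Jet n in 𝓝 (p : Jet n), ∀ h : q ∈ V, ⟨q, h⟩ ∈ solutionSet hV G →
      evalAt ⟨q, h⟩ W = evalAt p W := by
  classical
  obtain ⟨l, hl⟩ := exists_hasOrder W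
  obtain ⟨k, hk1, hk2, hk3⟩ : ∃ k, l ≤ k ∧ m₀ ≤ k ∧ N ≤ k := ⟨l + m₀ + N, by omega⟩
  have hWk := hl.mono hk1
  obtain ⟨F, hF⟩ := hWk
  let ι := {I : Fin n →₀ ℕ // I.degree ≤ k - N}
  have hfin : Finite ι := by
    refine Finite.of_injective (β := MultiIndexLE n (k - N))
      (fun I => ⟨I.1, by rw [deg_coe]; exact I.2⟩) fun I J h => ?_
    exact Subtype.ext (DFunLike.coe_injective (congrArg Subtype.val h))
  have := Fintype.ofFinite ι
  have hrep (I : ι) : ∃ Φ, Represents k Φ ((jetAlgebra hV).DD I.1 G).1 :=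
    (hG.DD hV I.1).mono (by have := I.2; omega)
  choose Φ hΦ using hrep
  have hO := isOpen_truncate_image hV k
  have hone : (1 : WithTop ℕ∞) ≤ ∞ := WithTop.coe_le_coe.2 le_top
  have hloc : ∀ᶠ z in 𝓝 (truncate k (p : Jet n)), (∀ I, Φ I z = 0) →
      F z = F (truncate k (p : Jet n)) := by
    refine eventually_eq_of_fderiv_eq_zero_on_ker hO ⟨p, p.2, rfl⟩
      (fun I => (hΦ I).1.of_le hone) (hF.1.of_le hone) (fun I => ?_) (fun c hc => ?_) ?_
    · rw [← (hΦ I).2 p]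
      exact hp I.1
    · have h1 : JetAlgebra.prolongation (jetAlgebra hV) G (evalAt p)
          (∑ I : ι, single I.1 (c I)) = 0 := by
        rw [← evPoly_vd_eq_prolongation hV (f := 0) (fun v => ?_), map_zero]
        · ext K; simp
        · rw [← Finsupp.sum_finsetSum_index (by simp) (by intros; ring), map_zero, map_zero,
            ← hc (truncate k v)]
          refine Finset.sum_congr rfl fun I _ => ?_
          rw [sum_single_index (by simp), evalAt_dirDeriv hV v (hΦ I)]
      have h2 := JetAlgebra.eq_zero_of_coeff_prolongation_eq_zero (fun _ => hG.dU_eq_zero hV) (hs p)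
        (m := 0) (fun K _ => by rw [h1, coeff_zero])
      funext I
      have h3 := h2 I.1 (by omega)
      rw [Finsupp.finsetSum_apply, Finset.sum_eq_single I, single_eq_same] at h3
      · exact h3
      · intro J _ hJ
        exact single_eq_of_ne' fun h => hJ (Subtype.ext h)
      · simp
    -- The vanishing of the derivative is needed at every nearby point of the finite-order zero set;
    -- each lifts to a formal solution, where the multipliers for `W` exist.
    · rintro _ ⟨q₀, hq₀, rfl⟩ hz w hw
      obtain ⟨q, hq, hsol⟩ := exists_solution_truncate_eq hV hG hcyl hs hk2 hk3 ⟨q₀, hq₀⟩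
        (fun I hI => by
          rw [evalAt_apply, (hΦ ⟨I, by omega⟩).2]
          exact hz ⟨I, by omega⟩)
      obtain ⟨c, hc⟩ := exists_multipliers_of_D_eq_zero hV hn hN hG hcyl hs hW hsol
      change truncate k (q : Jet n) = truncate k q₀ at hq
      -- As `W` has order at most `k`, only equations with `|I| ≤ k - N` occur, exactly those
      -- defining the level set.
      have hc0 := JetAlgebra.eq_zero_of_coeff_prolongation_eq_zero (fun _ => hG.dU_eq_zero hV) (hs q)
        (c := c) (m := k) (fun K hK => by
          rw [← evPoly_vd_eq_prolongation hV hc, JetAlgebra.coeff_evPoly, JetAlgebra.vd_apply,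
            HasOrder.dU_eq_zero hV ⟨F, hF⟩ hK, map_zero])
      rw [← hq] at hw ⊢
      rw [← truncate_splice k q w, ← evalAt_dirDeriv hV _ hF, hc]
      refine Finset.sum_eq_zero fun I hI => ?_
      have hIk : I.degree ≤ k - N := by
        by_contra h
        exact Finsupp.mem_support_iff.1 hI (hc0 I (by omega))
      change c I * evalAt q _ = 0
      rw [evalAt_dirDeriv hV _ (hΦ ⟨I, hIk⟩), truncate_splice, hw, mul_zero]
  have hcont : Continuous (truncate k : Jet n → FiniteJet n k) := (truncateL n k).continuous
  filter_upwards [hcont.continuousAt.eventually hloc] with q hq hqV hsol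
  rw [evalAt_apply, evalAt_apply, hF.2, hF.2]
  refine hq fun I => ?_
  rw [← (hΦ I).2 ⟨q, hqV⟩]
  exact hsol I.1

/-- Every point of an open set of jets has an open cylindrical neighbourhood in it. -/
theorem exists_cylinder {U : Set (Jet n)} (hU : IsOpen U) {p : Jet n} (hp : p ∈ U) :
    ∃ V ⊆ U, IsOpen V ∧ p ∈ V ∧
      ∃ m, ∀ p q : Jet n, truncate m p = truncate m q → p ∈ V → q ∈ V := by
  obtain ⟨a, b, ha, hb, hpa, hpb, hab⟩ := isOpen_prod_iff.1 hU p.1 p.2 hp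
  obtain ⟨I, w, hw, hwb⟩ := isOpen_pi_iff.1 hb p.2 hpb
  refine ⟨a ×ˢ (I : Set (Fin n → ℕ)).pi w, (Set.prod_mono_right hwb).trans hab,
    ha.prod (isOpen_set_pi I.finite_toSet fun J hJ => (hw J hJ).1),
    ⟨hpa, fun J hJ => (hw J hJ).2⟩, I.sup deg, ?_⟩
  rintro q q' h ⟨h1, h2⟩
  refine ⟨?_, fun J hJ => ?_⟩
  · have := congrArg Prod.fst h
    change q.1 = q'.1 at this
    rwa [← this]
  · have h3 : q.2 J = q'.2 J :=
      congrFun (congrArg Prod.snd h) ⟨J, Finset.le_sup (f := deg) hJ⟩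
    rw [← h3]
    exact h2 J hJ

end JetCalculus

/-! ### Transfer to functions on jet space and the rank bound. -/

namespace JetCalculus

open Finsupp

variable {n : ℕ}

/-- The restriction to `V` of a differential function on `U`, of order at most `k`. -/
theorem exists_diffAlg {U V : Set (Jet n)} (hVU : V ⊆ U) {k : ℕ} {g : Jet n → ℝ}
    (hg : IsDifferentialFunctionOfOrder U k g) :
    ∃ f : DiffAlg V, HasOrder k f ∧ ∀ q : V, g q = evalAt q f := by
  obtain ⟨F, hF, hgF⟩ := hg
  have hrep : Represents k F (fun q : V => g q) :=
    ⟨hF.mono (Set.image_mono hVU), fun q => hgF q (hVU q.2)⟩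
  exact ⟨⟨fun q => g q, k, F, hrep⟩, ⟨F, hrep⟩, fun _ => rfl⟩

theorem act_eq_adj_of_isEulerLagrange {U V : Set (Jet n)} (hV : IsOpen V) (hVU : V ⊆ U)
    {g : Jet n → ℝ} (hg : IsEulerLagrange U g) {f : DiffAlg V} (hf : ∀ q : V, g q = evalAt q f)
    (h : DiffAlg V) : (jetAlgebra hV).act ((jetAlgebra hV).vd f) h
      = (jetAlgebra hV).adj ((jetAlgebra hV).vd f) h := by
  obtain ⟨L, ⟨k, hL⟩, hLg⟩ := hg
  obtain ⟨L', -, hL'⟩ := exists_diffAlg hVU hL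
  have h1 : f = (jetAlgebra hV).euler L' := ext_evalAt fun q => by
    rw [← hf q, ← hLg q (hVU q.2), eulerOperator_eq hV hL']
  rw [h1, JetAlgebra.act_vd_euler]

theorem mem_formalSolutions_iff {U V : Set (Jet n)} (hV : IsOpen V) (hVU : V ⊆ U)
    {g : Jet n → ℝ} {f : DiffAlg V} (hf : ∀ q : V, g q = evalAt q f) (q : V) :
    (q : Jet n) ∈ formalSolutions U g ↔ q ∈ solutionSet hV f := by
  refine ⟨fun h I => ?_, fun h => ⟨hVU q.2, fun J => ?_⟩⟩
  · rw [← totalDMulti_eq hV hf]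
    exact h.2 I
  · exact (totalDMulti_eq hV hf q (equivFunOnFinite.symm J)).trans (h _)

theorem multiBinom_add_single (K : Fin n → ℕ) (i : Fin n) :
    multiBinom (K + Pi.single i 1) (Pi.single i 1) = K i + 1 := by
  unfold multiBinom
  rw [Finset.prod_eq_single i]
  · simp
  · intro j _ hj
    simp [Pi.single_eq_of_ne hj]
  · simp

theorem topDerivMatrix_apply {V : Set (Jet n)} (hV : IsOpen V) {N : ℕ} {g : Jet n → ℝ}
    {f : DiffAlg V} (hf : ∀ q : V, g q = evalAt q f) (q : V)
    (K : {K : Fin n → ℕ // deg K + 1 = N}) (i : Fin n) :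
    topDerivMatrix N g q K i = (K.1 i + 1 : ℝ) *
      evalAt q ((jetAlgebra hV).dU (equivFunOnFinite.symm K.1 + single i 1) f) := by
  have h1 : K.1 + (Pi.single i 1 : Fin n → ℕ) = (equivFunOnFinite.symm K.1 + single i 1 : Fin n →₀ ℕ) := by
    rw [Finsupp.coe_add, single_eq_pi_single]
    rfl
  change (multiBinom (K.1 + Pi.single i 1) (Pi.single i 1) : ℝ) * partialU _ g q = _
  rw [multiBinom_add_single, h1, partialU_eq hV hf]
  push_cast
  rfl

theorem continuous_evalAt {V : Set (Jet n)} (f : DiffAlg V) :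
    Continuous fun q : V => evalAt q f := by
  obtain ⟨k, F, hF⟩ := f.2
  have h1 : Continuous fun q : V => truncate k (q : Jet n) :=
    (truncateL n k).continuous.comp continuous_subtype_val
  have h2 := hF.1.continuousOn.comp_continuous h1 fun q => ⟨q, q.2, rfl⟩
  exact h2.congr fun q => (hF.2 q).symm

instance instFiniteDegSucc (n N : ℕ) : Finite {K : Fin n → ℕ // deg K + 1 = N} :=
  Finite.of_injective (β := MultiIndexLE n N) (fun K => ⟨K.1, by have := K.2; omega⟩)
    fun _ _ h => Subtype.ext (congrArg (fun K : MultiIndexLE n N => K.1) h)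

theorem mulVec_injective_of_rank_eq {m : Type*} {A : Matrix m (Fin n) ℝ} (hA : A.rank = n)
    {a : Fin n → ℝ} (ha : A.mulVec a = 0) : a = 0 := by
  have h1 := LinearMap.finrank_range_add_finrank_ker A.mulVecLin
  rw [Module.finrank_fin_fun] at h1
  have h2 : Module.finrank ℝ (LinearMap.ker A.mulVecLin) = 0 := by
    have : Module.finrank ℝ (LinearMap.range A.mulVecLin) = n := hA
    omega
  have h3 : a ∈ LinearMap.ker A.mulVecLin := ha
  rwa [Submodule.finrank_eq_zero.1 h2, Submodule.mem_bot] at h3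

theorem det_transpose_mul_self_ne_zero_iff {m : Type*} [Fintype m] {A : Matrix m (Fin n) ℝ} :
    (A.transpose * A).det ≠ 0 ↔ ∀ a, A.mulVec a = 0 → a = 0 := by
  rw [Ne, ← Matrix.exists_mulVec_eq_zero_iff]
  push Not
  have h (a : Fin n → ℝ) : (A.transpose * A).mulVec a = 0 ↔ A.mulVec a = 0 := by
    change a ∈ LinearMap.ker (A.transpose * A).mulVecLin ↔ a ∈ LinearMap.ker A.mulVecLin
    rw [Matrix.ker_mulVecLin_transpose_mul_self]
  simp only [Ne, h]
  exact forall_congr' fun a => ⟨fun h1 h2 => by_contra fun h3 => h1 h3 h2, fun h1 h2 h3 => h2 (h1 h3)⟩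

end JetCalculus

end

theorem proposition3p3 (n N : ℕ) (hn : 2 ≤ n) (hN : 1 ≤ N)
    (U : Set (Jet n)) (hU : IsOpen U) (G : Jet n → ℝ)
    (hG : IsDifferentialFunctionOfOrder U N G) (hGEL : IsEulerLagrange U G)
    (W : Jet n → ℝ) (hW : IsVariationalIntegratingFactor U G W) :
    ∀ p ∈ formalSolutions U G, IsNonconstantOnAt (formalSolutions U G) W p →
      (topDerivMatrix N G p).rank ≤ n - 1 := by
  intro p hp hnonconst
  by_contra hrank
  have hrank' : (topDerivMatrix N G p).rank = n := by
    have := (topDerivMatrix N G p).rank_le_card_width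
    rw [Fintype.card_fin] at this
    omega
  have := Fintype.ofFinite {K : Fin n → ℕ // deg K + 1 = N}
  obtain ⟨G₀, -, hG₀⟩ := exists_diffAlg subset_rfl hG
  -- Rank `n` means that the Gram determinant is nonzero, an open condition.
  have hcont : Continuous fun q : U =>
      ((topDerivMatrix N G q).transpose * topDerivMatrix N G q).det := by
    have h1 : Continuous fun q : U => topDerivMatrix N G q := by
      refine continuous_matrix fun K i => ?_
      simp only [topDerivMatrix_apply hU hG₀]
      exact continuous_const.mul (continuous_evalAt _)
    exact (h1.matrix_transpose.matrix_mul h1).matrix_det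
  have hopen : IsOpen (Subtype.val ''
      {q : U | ((topDerivMatrix N G q).transpose * topDerivMatrix N G q).det ≠ 0}) :=
    hU.isOpenMap_subtype_val _ (isOpen_ne_fun hcont continuous_const)
  -- A cylinder is needed so that changing the coordinates of order above `m₀` does not leave the
  -- neighbourhood.
  obtain ⟨V, hVsub, hV, hpV, m₀, hcyl⟩ := exists_cylinder hopen (p := p)
    ⟨⟨p, hp.1⟩, det_transpose_mul_self_ne_zero_iff.2 fun a =>
      mulVec_injective_of_rank_eq hrank', rfl⟩
  have hVU : V ⊆ U := fun q hq => by
    obtain ⟨q', -, rfl⟩ := hVsub hq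
    exact q'.2
  have hinj (q : V) (a : Fin n → ℝ) (ha : (topDerivMatrix N G q).mulVec a = 0) : a = 0 := by
    obtain ⟨q', h1, h2⟩ := hVsub q.2
    rw [← h2] at ha
    exact det_transpose_mul_self_ne_zero_iff.1 h1 a ha
  obtain ⟨f, hfN, hf⟩ := exists_diffAlg hVU hG
  obtain ⟨⟨k, hWk⟩, -, hWG⟩ := hW
  obtain ⟨w, -, hw⟩ := exists_diffAlg hVU hWk
  have hself := act_eq_adj_of_isEulerLagrange hV hVU hGEL hf
  have hself' := act_eq_adj_of_isEulerLagrange hV hVU hWG (f := w * f)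
    (fun q => by rw [map_mul, ← hf q, ← hw q])
  have hsymb (q : V) : JetAlgebra.symbol (jetAlgebra hV) f N (evalAt q) ≠ 0 := by
    intro h0
    -- A zero symbol would make the whole matrix zero, so any nonzero vector serves.
    have h1 : (topDerivMatrix N G q).mulVec 1 = 0 := by
      funext K
      rw [Matrix.mulVec, dotProduct, Pi.zero_apply]
      refine Finset.sum_eq_zero fun i _ => ?_
      have hK : (Finsupp.equivFunOnFinite.symm K.1).degree + 1 = N := by
        rw [← deg_coe]
        exact K.2
      rw [topDerivMatrix_apply hV hf, ← JetAlgebra.coeff_symbol_of_degree_eq (N := N), h0,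
        MvPolynomial.coeff_zero, mul_zero, zero_mul]
      rw [JetAlgebra.degree_add_single, hK]
    have h2 := congrFun (hinj q 1 h1) ⟨0, by omega⟩
    exact one_ne_zero h2
  have hD (q : V) (hq : q ∈ solutionSet hV f) (i : Fin n) :
      evalAt q ((jetAlgebra hV).D i w) = 0 := by
    refine congrFun (hinj q (fun i => evalAt q ((jetAlgebra hV).D i w)) ?_) i
    funext K
    have hK : (Finsupp.equivFunOnFinite.symm K.1).degree + 1 = N := by
      rw [← deg_coe]
      exact K.2
    rw [Matrix.mulVec, dotProduct, Pi.zero_apply]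
    refine Eq.trans ?_ ((jetAlgebra hV).sum_dU_mul_D_eq_zero hself hself' (evalAt q) hq
      (K := Finsupp.equivFunOnFinite.symm K.1)
      fun J hJ => hfN.dU_eq_zero hV (by omega))
    refine Finset.sum_congr rfl fun i _ => ?_
    rw [topDerivMatrix_apply hV hf]
    rfl
  have hloc := eventually_evalAt_eq hV hn hN hfN hcyl hsymb hD (p := ⟨p, hpV⟩)
    ((mem_formalSolutions_iff hV hVU hf ⟨p, hpV⟩).1 hp)
  refine hnonconst ⟨W p, ?_⟩
  filter_upwards [mem_nhdsWithin_of_mem_nhds hloc,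
    mem_nhdsWithin_of_mem_nhds (hV.mem_nhds hpV), self_mem_nhdsWithin] with q hq hqV hqE
  rw [hw ⟨q, hqV⟩, hw ⟨p, hpV⟩]
  exact hq hqV ((mem_formalSolutions_iff hV hVU hf ⟨q, hqV⟩).1 hqE)
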